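/- Let $X$ be a finite biquandle with operations $x^y=x\,\underline{\triangleright}\,y$ and $x_y=x\,\overline{\triangleright}\,y$ (so $x^x=x_x$; the maps $y\mapsto y_x$, $y\mapsto y^x$ and $(x,y)\mapsto(y_x,x^y)$ are bijective; and $(x^y)^{(z^y)}=(x^z)^{(y_z)}$, $(x^y)_{(z^y)}=(x_z)^{(y_z)}$, $(x_y)_{(z_y)}=(x_z)_{(y^z)}$). Let $R$ be a commutative ring with identity, and let $\beta$ be a biquandle bracket on $X$ over $R$: maps $A,B:X\times X\to R^\times$ such that $-A_{x,x}^2B_{x,x}^{-1}=w$ for all $x$, $-A_{x,y}^{-1}B_{x,y}-A_{x,y}B_{x,y}^{-1}=\delta$ for all $x,y$, and for all $x,y,z\in X$ $$\begin{array}{rcl} A_{x,y}A_{y,z}A_{x^y,z_y} & = & A_{x,z}A_{y_x,z_x}A_{x^z,y^z},\\ A_{x,y}B_{y,z}B_{x^y,z_y} & = & B_{x,z}B_{y_x,z_x}A_{x^z,y^z},\\ B_{x,y}A_{y,z}B_{x^y,z_y} & = & B_{x,z}A_{y_x,z_x}B_{x^z,y^z},\\ A_{x,y}A_{y,z}B_{x^y,z_y}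 & = & A_{x,z}B_{y_x,z_x}A_{x^z,y^z}+A_{x,z}A_{y_x,z_x}B_{x^z,y^z}+\delta A_{x,z}B_{y_x,z_x}B_{x^z,y^z}+B_{x,z}B_{y_x,z_x}B_{x^z,y^z},\\ B_{x,z}A_{y_x,z_x}A_{x^z,y^z} & = & B_{x,y}A_{y,z}A_{x^y,z_y}+A_{x,y}B_{y,z}A_{x^y,z_y}+\delta B_{x,y}B_{y,z}A_{x^y,z_y}+B_{x,y}B_{y,z}B_{x^y,z_y}. \end{array}$$ A trace diagram is an oriented planar diagram with crossings and signed traces, where a trace of type A or B, of sign $\pm$, is the site of a smoothed crossing of that sign. Type A is the smoothing that respects the orientation. Type B joins the two incoming edges at a sink and the two outgoing edges at a source. A link diagram is a trace diagram without traces. An $X$-coloring assigns elements of $X$ to the edges such that every positive crossing and every positive trace has, for some $x,y\in X$ (its labels), incoming under-edge $x$, outgoing under-edge $x^y$, incoming over-edge $y_x$ and outgoing over-edge $y$; at negative ones the incoming under-edge is $x^y$, the outgoing under-edge $x$, the incoming over-edge $y$ and the outgoing over-edge $y_x$. The edges at a trace are named as at the crossing that it replaces. Then there is exactly one map $[\ ]$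 from the $X$-colored oriented trace diagrams to $R$ with the following two properties. 1. For every crossing of $D$, with labels $x,y$, let $D_A,D_B$ be obtained from $D$ by replacing this crossing by a trace of the same sign and of type A, B respectively. Then $[D]=A_{x,y}[D_A]+B_{x,y}[D_B]$ if the crossing is positive, and $[D]=A_{x,y}^{-1}[D_A]+B_{x,y}^{-1}[D_B]$ if it is negative. 2. If $D$ has no crossings, then $[D]=w^{n-p}\delta^k$, where $n$ and $p$ are the numbers of negative and positive traces and $k$ is the number of closed curves that remain when all traces are deleted. Moreover, for every $X$-colored oriented link diagram $L_f$, the value $[L_f]$ is unchanged by $X$-colored Reidemeister moves (all oriented versions of moves I, II and III, with the colors unchanged outside the disc in which the move takes place). Finally, $[L_f]=\beta(L_f)$, where $$\beta(L_f)=w^{n-p}\sum_{\text{states}}\Big(\prod_{j}C_j\Big)\delta^{k}$$ is the state sum. Here $n,p$ are the numbers of negative and positive crossings of $L_f$. A state chooses the A- or the B-smoothing at every crossing $j$, $C_j$ is the corresponding coefficient $A_{x,y}^{\pm1}$ or $B_{x,y}^{\pm1}$ (exponent equal to the sign of the crossing, with $x,y$ its labels), and $k$ is the number of closed curves of the smoothed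 diagram. -/

import Mathlib

/-! ### Biquandles and biquandle brackets -/

/-- A biquandle. `underOp x y` is `x ▷̲ y` (also written `x^y`) and `overOp x y` is
`x ▷̅ y` (also written `x_y`). -/
class Biquandle (X : Type*) where
  underOp : X → X → X
  overOp : X → X → X
  under_self : ∀ x, underOp x x = overOp x x
  bijective_over : ∀ x, Function.Bijective fun y => overOp y x
  bijective_under : ∀ x, Function.Bijective fun y => underOp y x
  bijective_sideways : Function.Bijective fun p : X × X => (overOp p.2 p.1, underOp p.1 p.2)
  exchange_under_under : ∀ x y z,
    underOp (underOp x y) (underOp z y) = underOp (underOp x z) (overOp y z)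
  exchange_under_over : ∀ x y z,
    overOp (underOp x y) (underOp z y) = underOp (overOp x z) (overOp y z)
  exchange_over_over : ∀ x y z,
    overOp (overOp x y) (overOp z y) = overOp (overOp x z) (underOp y z)

open Biquandle in
/-- A biquandle bracket on the biquandle `X` with values in the commutative ring `R`.
`w` and `δ` are the common values of the expressions in `w_eq` and `δ_eq`. -/
structure BiquandleBracket (X : Type*) [Biquandle X] (R : Type*) [CommRing R] where
  A : X → X → Rˣ
  B : X → X → Rˣ
  w : Rˣ
  δ : R
  w_eq : ∀ x, -(A x x ^ 2 * (B x x)⁻¹) = w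
  δ_eq : ∀ x y, -(((A x y)⁻¹ * B x y : Rˣ) : R) - ((A x y * (B x y)⁻¹ : Rˣ) : R) = δ
  eq₁ : ∀ x y z, A x y * A y z * A (underOp x y) (overOp z y) =
    A x z * A (overOp y x) (overOp z x) * A (underOp x z) (underOp y z)
  eq₂ : ∀ x y z, A x y * B y z * B (underOp x y) (overOp z y) =
    B x z * B (overOp y x) (overOp z x) * A (underOp x z) (underOp y z)
  eq₃ : ∀ x y z, B x y * A y z * B (underOp x y) (overOp z y) =
    B x z * A (overOp y x) (overOp z x) * B (underOp x z) (underOp y z)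
  eq₄ : ∀ x y z, (A x y * A y z * B (underOp x y) (overOp z y) : R) =
    A x z * B (overOp y x) (overOp z x) * A (underOp x z) (underOp y z) +
    A x z * A (overOp y x) (overOp z x) * B (underOp x z) (underOp y z) +
    δ * A x z * B (overOp y x) (overOp z x) * B (underOp x z) (underOp y z) +
    B x z * B (overOp y x) (overOp z x) * B (underOp x z) (underOp y z)
  eq₅ : ∀ x y z, (B x y * A y z * A (underOp x y) (overOp z y) : R) +
    A x y * B y z * A (underOp x y) (overOp z y) +
    δ * B x y * B y z * A (underOp x y) (overOp z y) +
    B x y * B y z * B (underOp x y) (overOp z y) =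
    B x z * A (overOp y x) (overOp z x) * A (underOp x z) (underOp y z)

/-! ### Trace diagrams -/

/-- The over-strand and the under-strand through a crossing. -/
inductive Strand
  | upper
  | lower
  deriving DecidableEq

/-- The two ways to smooth a crossing, which are also the two types of traces: type `A` is the
smoothing that respects the orientations, type `B` joins the two incoming edges at a bivalent
sink and the two outgoing edges at a bivalent source. -/
inductive Smoothing
  | A
  | B
  deriving DecidableEq

instance : Fintype Smoothing := ⟨{.A, .B}, fun t => by cases t <;> simp⟩

/-- A four-ended site of a trace diagram is a crossing, or it is a trace together with its two
endpoints. -/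
inductive SiteKind
  | crossing
  | trace (t : Smoothing)

/-- The two ends of an oriented edge at a vertex: the edge arrives, or it leaves. -/
inductive Direction
  | incoming
  | outgoing

/-- Counterclockwise rotation of the ends around each site and each point, see
`TraceDiagram.rotate`. Counterclockwise from its incoming lower end, a positive site has the
ends lower in, upper out, lower out, upper in, and a negative site has the ends
lower in, upper in, lower out, upper out. -/
def rotateEnd {S P : Type} (sign : S → ℤˣ) :
    (S × Strand ⊕ P) × Direction → (S × Strand ⊕ P) × Direction
  | (Sum.inr p, .incoming) => (Sum.inr p, .outgoing)
  | (Sum.inr p, .outgoing) => (Sum.inr p, .incoming)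
  | (Sum.inl (s, .lower), .incoming) =>
      (Sum.inl (s, .upper), if sign s = 1 then .outgoing else .incoming)
  | (Sum.inl (s, .upper), .outgoing) =>
      (Sum.inl (s, .lower), if sign s = 1 then .outgoing else .incoming)
  | (Sum.inl (s, .lower), .outgoing) =>
      (Sum.inl (s, .upper), if sign s = 1 then .incoming else .outgoing)
  | (Sum.inl (s, .upper), .incoming) =>
      (Sum.inl (s, .lower), if sign s = 1 then .incoming else .outgoing)

/-- Passage to the other end of the same edge, see `TraceDiagram.flip`. -/
def flipEnd {V : Type} (next : Equiv.Perm V) : V × Direction → V × Direction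
  | (v, .outgoing) => (next v, .incoming)
  | (v, .incoming) => (next.symm v, .outgoing)

/-- The combinatorial data of an oriented diagram with crossings and signed traces (planarity is
the condition `TraceDiagram.IsPlanar` below).

Every site has two incoming and two outgoing ends. For a crossing they belong to the over- and to
the under-strand. A trace of sign `ε` has the same four ends, named as at the crossing of
sign `ε` from which it arises by smoothing.

Besides the sites, a diagram carries finitely many bivalent marked points on its strands. They
have no meaning except that a closed strand that passes through no site carries at least one of
them; see `ReidemeisterPair.subdivide`.

`next v` is the vertex that is reached by leaving the vertex `v`; so the edges of the
diagram correspond to the vertices at which they arrive. -/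
structure TraceDiagram where
  Site : Type
  Point : Type
  [fintypeSite : Fintype Site]
  [decidableEqSite : DecidableEq Site]
  [finitePoint : Finite Point]
  kind : Site → SiteKind
  sign : Site → ℤˣ
  next : Equiv.Perm (Site × Strand ⊕ Point)

attribute [instance] TraceDiagram.fintypeSite TraceDiagram.decidableEqSite
  TraceDiagram.finitePoint

namespace TraceDiagram

/-- The vertices through which the oriented strands run: each site twice, once along each
strand, and each marked point once. -/
abbrev Vertex (D : TraceDiagram) : Type := D.Site × Strand ⊕ D.Point

/-- The passage of the site `s` along the strand `a`. -/
abbrev pass (D : TraceDiagram) (s : D.Site) (a : Strand) : D.Vertex := Sum.inl (s, a)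

/-- The end of an edge at a vertex. -/
abbrev End (D : TraceDiagram) : Type := D.Vertex × Direction

/-- The next end in counterclockwise order around the same site or point. A crossing is
positive if turning the direction of the over-strand counterclockwise by less than a straight
angle gives the direction of the under-strand. -/
def rotate (D : TraceDiagram) : D.End → D.End :=
  rotateEnd D.sign

/-- The other end of the same edge. -/
def flip (D : TraceDiagram) : D.End → D.End :=
  flipEnd D.next

/-- The number of faces of the ribbon graph of the diagram. -/
noncomputable def faceCount (D : TraceDiagram) : ℕ :=
  Nat.card (Quot fun a b : D.End => b = D.rotate (D.flip a))

/-- The number of connected components of the diagram, as a graph. -/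
noncomputable def pieceCount (D : TraceDiagram) : ℕ :=
  Nat.card (Quot fun a b : D.End => b = D.rotate a ∨ b = D.flip a)

/-- Every connected piece of the diagram is embedded in a sphere, by Euler's formula. With `n`
sites and `m` points there are `n + m` vertices and `2 * n + m` edges. -/
def IsPlanar (D : TraceDiagram) : Prop :=
  D.faceCount = Fintype.card D.Site + 2 * D.pieceCount

/-- Two edges (given by the vertices at which they arrive) belong to the same curve near some
vertex, after the traces are deleted. -/
inductive Adjacent (D : TraceDiagram) : D.Vertex → D.Vertex → Prop
  | point (p : D.Point) : Adjacent D (Sum.inr p) (D.next (Sum.inr p))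
  | crossing (s : D.Site) (a : Strand) (h : D.kind s = .crossing) :
      Adjacent D (D.pass s a) (D.next (D.pass s a))
  | traceA_left (s : D.Site) (h : D.kind s = .trace .A) :
      Adjacent D (D.pass s .lower) (D.next (D.pass s .upper))
  | traceA_right (s : D.Site) (h : D.kind s = .trace .A) :
      Adjacent D (D.pass s .upper) (D.next (D.pass s .lower))
  | traceB_sink (s : D.Site) (h : D.kind s = .trace .B) :
      Adjacent D (D.pass s .lower) (D.pass s .upper)
  | traceB_source (s : D.Site) (h : D.kind s = .trace .B) :
      Adjacent D (D.next (D.pass s .lower)) (D.next (D.pass s .upper))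

/-- The number of components (closed curves) of the diagram obtained by deleting all traces. -/
noncomputable def componentCount (D : TraceDiagram) : ℕ := Nat.card (Quot D.Adjacent)

/-- The number of positive sites. -/
def numPos (D : TraceDiagram) : ℕ := (Finset.univ.filter fun s => D.sign s = 1).card

/-- The number of negative sites. -/
def numNeg (D : TraceDiagram) : ℕ := (Finset.univ.filter fun s => D.sign s = -1).card

/-- A diagram without traces. -/
def IsLinkDiagram (D : TraceDiagram) : Prop := ∀ s, D.kind s = .crossing

end TraceDiagram

/-! ### Biquandle colorings -/

/-- An `X`-colored oriented (planar) trace diagram. `color v` is the color of the edge that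
arrives at `v`, so that `color (next v)` is the color of the edge that leaves `v`.
Traces satisfy the coloring conditions of the crossings of the same sign. -/
structure ColoredTraceDiagram (X : Type*) [Biquandle X] extends TraceDiagram where
  planar : toTraceDiagram.IsPlanar
  color : toTraceDiagram.Vertex → X
  color_point : ∀ p : Point, color (next (Sum.inr p)) = color (Sum.inr p)
  color_under_pos : ∀ s, sign s = 1 → color (next (toTraceDiagram.pass s .lower)) =
    Biquandle.underOp (color (toTraceDiagram.pass s .lower))
      (color (next (toTraceDiagram.pass s .upper)))
  color_over_pos : ∀ s, sign s = 1 → color (toTraceDiagram.pass s .upper) =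
    Biquandle.overOp (color (next (toTraceDiagram.pass s .upper)))
      (color (toTraceDiagram.pass s .lower))
  color_under_neg : ∀ s, sign s = -1 → color (toTraceDiagram.pass s .lower) =
    Biquandle.underOp (color (next (toTraceDiagram.pass s .lower)))
      (color (toTraceDiagram.pass s .upper))
  color_over_neg : ∀ s, sign s = -1 → color (next (toTraceDiagram.pass s .upper)) =
    Biquandle.overOp (color (toTraceDiagram.pass s .upper))
      (color (next (toTraceDiagram.pass s .lower)))

namespace ColoredTraceDiagram

variable {X : Type*} [Biquandle X]

/-- The color `x` of the pair of left-hand colors `(x, y)` at a site, on the under-strand. -/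
def underLabel (D : ColoredTraceDiagram X) (s : D.Site) : X :=
  if D.sign s = 1 then D.color (D.pass s .lower) else D.color (D.next (D.pass s .lower))

/-- The color `y` of the pair of left-hand colors `(x, y)` at a site, on the over-strand. -/
def overLabel (D : ColoredTraceDiagram X) (s : D.Site) : X :=
  if D.sign s = 1 then D.color (D.next (D.pass s .upper)) else D.color (D.pass s .upper)

/-- Change the kinds of the sites, keeping edges, signs and colors. -/
def withKind (D : ColoredTraceDiagram X) (k : D.Site → SiteKind) : ColoredTraceDiagram X :=
  { D with
    kind := k
    planar := D.planar }

/-- Replace the site `s` by a trace of type `t` and of the same sign. -/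
def smooth (D : ColoredTraceDiagram X) (s : D.Site) (t : Smoothing) : ColoredTraceDiagram X :=
  D.withKind (Function.update D.kind s (.trace t))

/-- The smoothed diagram of a state, with the site `s` smoothed by `σ s`. -/
def smoothAll (D : ColoredTraceDiagram X) (σ : D.Site → Smoothing) : ColoredTraceDiagram X :=
  D.withKind fun s => .trace (σ s)

end ColoredTraceDiagram

/-! ### The two bracket values -/

namespace BiquandleBracket

variable {X : Type*} [Biquandle X] {R : Type*} [CommRing R]

/-- The skein coefficient of a smoothing at a site: `A x y` or `B x y` at a positive
site, `(A x y)⁻¹` or `(B x y)⁻¹` at a negative one. -/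
def coeff (β : BiquandleBracket X R) (D : ColoredTraceDiagram X) (s : D.Site) :
    Smoothing → Rˣ
  | .A => β.A (D.underLabel s) (D.overLabel s) ^ ((D.sign s : ℤˣ) : ℤ)
  | .B => β.B (D.underLabel s) (D.overLabel s) ^ ((D.sign s : ℤˣ) : ℤ)

/-- The writhe correction factor `w ^ (n - p)`. -/
def writheFactor (β : BiquandleBracket X R) (D : ColoredTraceDiagram X) : Rˣ :=
  β.w ^ ((D.numNeg : ℤ) - (D.numPos : ℤ))

/-- The state-sum value of an `X`-colored oriented link diagram. -/
noncomputable def stateSum (β : BiquandleBracket X R) (L : ColoredTraceDiagram X) : R :=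
  (β.writheFactor L : R) * ∑ σ : L.Site → Smoothing,
    (∏ s, (β.coeff L s (σ s) : R)) * β.δ ^ (L.smoothAll σ).componentCount

/-- The recursive rules for the trace diagram bracket: the skein relation at every crossing, and
the value of the diagrams that have no crossings. -/
structure IsTraceBracket (β : BiquandleBracket X R) (br : ColoredTraceDiagram X → R) : Prop where
  skein : ∀ (D : ColoredTraceDiagram X) (s : D.Site), D.kind s = .crossing →
    br D = β.coeff D s .A * br (D.smooth s .A) + β.coeff D s .B * br (D.smooth s .B)
  no_crossing : ∀ D : ColoredTraceDiagram X, (∀ s, D.kind s ≠ .crossing) →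
    br D = (β.writheFactor D : R) * β.δ ^ D.componentCount

end BiquandleBracket

/-! ### Reidemeister moves -/

/-- The part of a diagram in a disc that it meets in `m` oriented arcs. `arc i` lists the
vertices on the `i`-th arc from its entry to its exit. All sites are crossings. -/
structure DiscTangle (m : ℕ) where
  Site : Type
  Point : Type
  sign : Site → ℤˣ
  arc : Fin m → List (Site × Strand ⊕ Point)

namespace DiscTangle

/-- `m` arcs without vertices. -/
def bare (m : ℕ) : DiscTangle m where
  Site := Empty
  Point := Empty
  sign := Empty.elim
  arc _ := []

/-- One arc, on which one point is marked. -/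
def marked : DiscTangle 1 where
  Site := Empty
  Point := Unit
  sign := Empty.elim
  arc _ := [Sum.inr ()]

/-- A kink of sign `ε`, which passes its crossing first along `a` and then along `b`. -/
def kink (ε : ℤˣ) (a b : Strand) : DiscTangle 1 where
  Site := Unit
  Point := Empty
  sign _ := ε
  arc _ := [Sum.inl ((), a), Sum.inl ((), b)]

/-- `[a, b]` if `τ = 1` and `[b, a]` if `τ = -1`. -/
def ordered {α : Type} (τ : ℤˣ) (a b : α) : List α := if τ = 1 then [a, b] else [b, a]

/-- Two arcs that form a bigon with crossings `0` and `1` of the signs `ε` and `-ε`. Arc `0`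
passes over arc `1`. The arcs are parallel if `τ = 1` and antiparallel if `τ = -1`. -/
def bigon (ε τ : ℤˣ) : DiscTangle 2 where
  Site := Fin 2
  Point := Empty
  sign := ![ε, -ε]
  arc := ![[Sum.inl (0, .upper), Sum.inl (1, .upper)],
    ordered τ (Sum.inl (0, .lower)) (Sum.inl (1, .lower))]

/-- Three arcs that form a triangle: arc `0` on top, arc `1` in the middle and arc `2` at the
bottom. The crossings are `0` (arc `0` over arc `1`), `1` (arc `0` over arc `2`) and
`2` (arc `1` over arc `2`), of the signs `ε 0`, `ε 1`, `ε 2`. The top arc passes crossing `0`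
before crossing `1` if and only if `τ = 1`; the signs and `τ` determine the orders along the two
other arcs, as they do for three oriented straight lines in the plane. -/
def triangle (ε : Fin 3 → ℤˣ) (τ : ℤˣ) : DiscTangle 3 where
  Site := Fin 3
  Point := Empty
  sign := ε
  arc := ![ordered τ (Sum.inl (0, .upper)) (Sum.inl (1, .upper)),
    ordered (τ * ε 1 * ε 2) (Sum.inl (0, .lower)) (Sum.inl (2, .upper)),
    ordered (τ * ε 0 * ε 2) (Sum.inl (1, .lower)) (Sum.inl (2, .lower))]

end DiscTangle

/-- The pairs of disc tangles that the moves exchange: none (a relabelling of a diagram),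
the marking of a point on an edge, and the oriented Reidemeister moves I, II, III
of all types. -/
inductive ReidemeisterPair : {m : ℕ} → DiscTangle m → DiscTangle m → Prop
  | relabel : ReidemeisterPair (DiscTangle.bare 0) (DiscTangle.bare 0)
  | subdivide : ReidemeisterPair (DiscTangle.bare 1) DiscTangle.marked
  | moveI_over (ε : ℤˣ) : ReidemeisterPair (DiscTangle.bare 1) (DiscTangle.kink ε .upper .lower)
  | moveI_under (ε : ℤˣ) : ReidemeisterPair (DiscTangle.bare 1) (DiscTangle.kink ε .lower .upper)
  | moveII (ε τ : ℤˣ) : ReidemeisterPair (DiscTangle.bare 2) (DiscTangle.bigon ε τ)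
  | moveIII (ε : Fin 3 → ℤˣ) :
      ReidemeisterPair (DiscTangle.triangle ε 1) (DiscTangle.triangle ε (-1))

/-- Leaving `v`, one passes exactly the vertices of the list, in this order, before `w`. -/
def TraceDiagram.Route (D : TraceDiagram) : D.Vertex → List D.Vertex → D.Vertex → Prop
  | v, [], w => D.next v = w
  | v, u :: l, w => D.next v = u ∧ D.Route u l w

/-- `D` is obtained by inserting the disc tangle `T`. The diagram `O` records what is outside the
disc: the outside vertices, and how the edges connect them if the `i`-th arc of the tangle is
contracted to a point on the edge that leaves `port i`. (`O` alone need not be planar.) -/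
structure Insertion (O : TraceDiagram) {m : ℕ} (port : Fin m ↪ O.Vertex) (T : DiscTangle m)
    (D : TraceDiagram) where
  site : O.Site ⊕ T.Site ≃ D.Site
  point : O.Point ⊕ T.Point ≃ D.Point
  kind_outside : ∀ s, D.kind (site (Sum.inl s)) = O.kind s
  kind_inside : ∀ s, D.kind (site (Sum.inr s)) = .crossing
  sign_outside : ∀ s, D.sign (site (Sum.inl s)) = O.sign s
  sign_inside : ∀ s, D.sign (site (Sum.inr s)) = T.sign s
  /-- the outside vertices, as vertices of `D` -/
  outside : O.Vertex → D.Vertex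
  outside_eq : outside =
    Sum.map (fun p => (site (Sum.inl p.1), p.2)) (fun p => point (Sum.inl p))
  /-- the vertices of the tangle, as vertices of `D` -/
  inside : T.Site × Strand ⊕ T.Point → D.Vertex
  inside_eq : inside =
    Sum.map (fun p => (site (Sum.inr p.1), p.2)) (fun p => point (Sum.inr p))
  next_outside : ∀ v, v ∉ Set.range port → D.next (outside v) = outside (O.next v)
  route : ∀ i, D.Route (outside (port i)) ((T.arc i).map inside) (outside (O.next (port i)))

/-- `D'` arises from `D` by one colored move: the diagrams agree outside of a disc, inside of it
they are the two sides of a move, and the colors agree on all edges that reach outside the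
disc. -/
def ColoredMove {X : Type*} [Biquandle X] (D D' : ColoredTraceDiagram X) : Prop :=
  ∃ (m : ℕ) (T T' : DiscTangle m) (_ : ReidemeisterPair T T') (O : TraceDiagram)
    (port : Fin m ↪ O.Vertex) (I : Insertion O port T D.toTraceDiagram)
    (I' : Insertion O port T' D'.toTraceDiagram),
    (∀ v, D.color (I.outside v) = D'.color (I'.outside v)) ∧
    ∀ v, D.color (D.next (I.outside v)) = D'.color (D'.next (I'.outside v))

/-- Being related by a finite sequence of colored Reidemeister moves and of their inverses. -/
def ColoredReidemeisterEquiv {X : Type*} [Biquandle X] :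
    ColoredTraceDiagram X → ColoredTraceDiagram X → Prop :=
  Relation.EqvGen ColoredMove

/-!
The bracket is the state sum. For a trace diagram `D` let `β.traceBracket D` be the sum over all
smoothings of all sites, where a trace contributes the factor `1` if it is smoothed according to its
type and `0` otherwise. Expanding the factor of one crossing gives the skein relation, and without
crossings a single state remains; so this is a trace bracket
(`BiquandleBracket.isTraceBracket_traceBracket`). The rules determine the bracket by induction on the
number of crossings (`BiquandleBracket.IsTraceBracket.eq`), and for link diagrams the sum is the state
sum by definition.

For the invariance under a move, the states are sorted by what they do outside of the disc. Such
an outside state sees the inside only through the way in which the smoothed tangle joins the edges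
that cross the boundary of the disc (its pattern) and through the number of closed curves in the disc
(`Insertion.card_quot_smoothedAdj`, `card_quot_glue`). Hence it suffices to prove an identity between
formal linear combinations of patterns for each move
(`BiquandleBracket.traceBracket_eq_of_tangleSum_eq`). The embedding in the plane plays no role in this.
Patterns and closed curves of the finitely many tangles are computed by a union-find algorithm on the
edges in the disc (`Course.label_eq_iff`) and compared by evaluation.

For moves I and II the identities are the definitions of `w` and `δ`. For moves of type III only the
ratios `B / A` matter, since the products of the coefficients `A` on the two sides are equal. If all
crossings are positive, the five bracket equations say, in terms of ratios,
`(1 + t₀ U₁) (1 + t₁ U₂) (1 + t₂ U₁) = (1 + s₂ U₂) (1 + s₁ U₁) (1 + s₀ U₂)` in the Temperley-Lieb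
algebra on three strands, where `t` and `s` are the ratios on the two sides (`BraidRelation`). Since `δ` is
the value of a closed curve, `1 + t U` is inverse to `1 + t⁻¹ U`, so factors can be moved to the other
side. This rotates the triangle (`BraidRelation.rotate`) and reaches the six sign patterns
whose strands can be directed to one side. The two cyclic triangles arise by turning
one strand around (`BraidRelation.cyclic`). The biquandle axioms ensure that the labels follow
the same scheme: a negative crossing carries the label of its counterpart on the other
side of the move (`triangle_labels`).
-/

open Relation Biquandle

/-! ### Relations between the ratios of the coefficients -/

section Ratios

variable {R : Type*} [CommRing R] {δ : R} {u m w u' m' w' : Rˣ}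

/-- The element `δ` is the value of a closed curve for coefficients of ratio `u`; equivalently,
in a Temperley-Lieb algebra with `U ^ 2 = δ U` the element `1 + u U` has the inverse
`1 + u⁻¹ U`. -/
def IsLoopValue (δ : R) (u : Rˣ) : Prop := δ = -(u + (u⁻¹ : Rˣ))

theorem IsLoopValue.eq {u : Rˣ} (h : IsLoopValue δ u) : δ = -(u + (u⁻¹ : Rˣ)) := h

theorem IsLoopValue.inv {u : Rˣ} (h : IsLoopValue δ u) : IsLoopValue δ u⁻¹ := by
  unfold IsLoopValue at *
  rw [inv_inv, h, add_comm]

/-- The coefficients of the identity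
`(1 + u U₁) (1 + m U₂) (1 + w U₁) = (1 + w' U₂) (1 + m' U₁) (1 + u' U₂)`
in the basis `1, U₁, U₂, U₁ U₂, U₂ U₁` of the Temperley-Lieb algebra on three strands, and
the condition that `δ` is the value of a closed curve for each of the six ratios. -/
structure BraidRelation (δ : R) (u m w u' m' w' : Rˣ) : Prop where
  left : (u + w + δ * u * w + u * m * w : R) = m'
  right : (m : R) = u' + w' + δ * u' * w' + u' * m' * w'
  first : m * u = m' * u'
  last : m * w = m' * w'
  loop_u : IsLoopValue δ u
  loop_m : IsLoopValue δ m
  loop_w : IsLoopValue δ w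
  loop_u' : IsLoopValue δ u'
  loop_m' : IsLoopValue δ m'
  loop_w' : IsLoopValue δ w'

namespace BraidRelation

theorem reverse (h : BraidRelation δ u m w u' m' w') : BraidRelation δ w m u w' m' u' where
  left := by linear_combination h.left
  right := by linear_combination h.right
  first := h.last
  last := h.first
  loop_u := h.loop_w
  loop_m := h.loop_m
  loop_w := h.loop_u
  loop_u' := h.loop_w'
  loop_m' := h.loop_m'
  loop_w' := h.loop_u'

theorem symm (h : BraidRelation δ u m w u' m' w') : BraidRelation δ u' m' w' u m w where
  left := h.right.symm
  right := h.left.symm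
  first := h.first.symm
  last := h.last.symm
  loop_u := h.loop_u'
  loop_m := h.loop_m'
  loop_w := h.loop_w'
  loop_u' := h.loop_u
  loop_m' := h.loop_m
  loop_w' := h.loop_w

theorem inv_mul_left (h : BraidRelation δ u m w u' m' w') :
    ((w⁻¹ : Rˣ) * m' : R) = 1 - w * u + u * m := by
  linear_combination (-(w⁻¹ : Rˣ) : R) * h.left + (1 + δ * u + u * m) * w.mul_inv + u * h.loop_w.eq

theorem inv_mul_right (h : BraidRelation δ u m w u' m' w') :
    ((w'⁻¹ : Rˣ) * m : R) = 1 - w' * u' + u' * m' := by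
  linear_combination ((w'⁻¹ : Rˣ) : R) * h.right + (1 + δ * u' + u' * m') * w'.mul_inv +
    u' * h.loop_w'.eq

/-- The coefficient of `U₂ U₁` after the factors with `w` and `w'` have been moved to the other
sides. -/
theorem outer (h : BraidRelation δ u m w u' m' w') : u * w = u' * w' := by
  have h₁ := congrArg Units.val h.first
  have h₂ : w'⁻¹ * m = w⁻¹ * m' := by
    rw [inv_mul_eq_iff_eq_mul, mul_left_comm, eq_inv_mul_iff_mul_eq, mul_comm w, mul_comm w']
    exact h.last
  replace h₂ := congrArg Units.val h₂
  push_cast at h₁ h₂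
  ext
  push_cast
  linear_combination h₁ + h.inv_mul_left - h.inv_mul_right + h₂

/-- Rotation of a triangle: the crossings with the ratios `w` and `w'` are moved to the other
sides of the braid relation, where they appear inverted. -/
theorem rotate (h : BraidRelation δ u m w u' m' w') : BraidRelation δ w'⁻¹ u m w⁻¹ u' m' where
  left := by
    have h₁ := congrArg Units.val h.first
    push_cast at h₁
    linear_combination ((w'⁻¹ : Rˣ) : R) * (h₁ - h.inv_mul_right) +
      ((w'⁻¹ : Rˣ) : R) * m * h.loop_w'.eq + (u' - m : R) * w'.mul_inv
  right := by
    have h₁ := congrArg Units.val h.first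
    push_cast at h₁
    linear_combination ((w⁻¹ : Rˣ) : R) * (h₁ + h.inv_mul_left) -
      ((w⁻¹ : Rˣ) : R) * m' * h.loop_w.eq - (u - m' : R) * w.mul_inv
  first := by
    rw [mul_inv_eq_iff_eq_mul, mul_right_comm, eq_mul_inv_iff_mul_eq]
    exact h.outer
  last := by rw [mul_comm u, mul_comm u', h.first]
  loop_u := h.loop_w'.inv
  loop_m := h.loop_u
  loop_w := h.loop_m
  loop_u' := h.loop_w.inv
  loop_m' := h.loop_u'
  loop_w' := h.loop_m'

end BraidRelation

/-- The relation between the ratios for a triangle whose sides are cyclically oriented. -/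
structure CyclicRelation (δ : R) (u m w u' m' w' : Rˣ) : Prop where
  left : (δ + u + m + w : R) = u' * m' * w'
  right : (u * m * w : R) = δ + u' + m' + w'
  first : m * u = m' * u'
  last : m * w = m' * w'
  outer : u * w = u' * w'

/-- Turning the middle strand around exchanges the two smoothings of its crossings. -/
theorem BraidRelation.cyclic (h : BraidRelation δ u m w u' m' w') :
    CyclicRelation δ u m'⁻¹ w u' m⁻¹ w' where
  left := by
    have h₀ := congrArg Units.val h.outer
    push_cast at h₀
    linear_combination h.left + h.loop_m'.eq - (u * w : R) * h.loop_m.eq + ((m⁻¹ : Rˣ) : R) * h₀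
  right := by
    have h₀ := congrArg Units.val h.outer
    push_cast at h₀
    linear_combination h.right - h.loop_m.eq + (u' * w' : R) * h.loop_m'.eq +
      ((m'⁻¹ : Rˣ) : R) * h₀
  first := by
    rw [inv_mul_eq_iff_eq_mul, mul_left_comm, eq_inv_mul_iff_mul_eq]
    exact h.first
  last := by
    rw [inv_mul_eq_iff_eq_mul, mul_left_comm, eq_inv_mul_iff_mul_eq]
    exact h.last
  outer := h.outer

end Ratios

/-! ### Counting classes of a glued relation -/

section Labels

variable {W : Type*} (num : W → ℕ)

/-- The label of a node in a list of labels. -/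
def labelOf (l : List ℕ) (u : W) : ℕ := l.getD (num u) 0

/-- Identify the labels of the two ends of an edge. -/
def mergeLabels (l : List ℕ) (e : W × W) : List ℕ :=
  l.map fun c => if c = labelOf num l e.1 ∨ c = labelOf num l e.2 then
    min (labelOf num l e.1) (labelOf num l e.2) else c

variable {num}

theorem labelOf_mergeLabels {l : List ℕ} (e : W × W) {u : W} (hu : num u < l.length) :
    labelOf num (mergeLabels num l e) u =
      if labelOf num l u = labelOf num l e.1 ∨ labelOf num l u = labelOf num l e.2 then
        min (labelOf num l e.1) (labelOf num l e.2) else labelOf num l u := by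
  simp [mergeLabels, labelOf, hu]

/-- Union-find: merging along a list of edges computes the equivalence relation that the edges
generate together with equality of the initial labels. -/
theorem labelOf_foldl_eq_iff (es : List (W × W)) : ∀ {l : List ℕ},
    (∀ u, num u < l.length) → ∀ u v,
    (labelOf num (es.foldl (mergeLabels num) l) u = labelOf num (es.foldl (mergeLabels num) l) v ↔
      EqvGen (fun a b => labelOf num l a = labelOf num l b ∨ (a, b) ∈ es) u v) := by
  induction es with
  | nil =>
    intro l _ u v
    simp only [List.foldl_nil, List.not_mem_nil, or_false]
    refine ⟨fun h => .rel _ _ h, fun h => ?_⟩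
    induction h with
    | rel _ _ h => exact h
    | refl => rfl
    | symm _ _ _ h => exact h.symm
    | trans _ _ _ _ _ h₁ h₂ => exact h₁.trans h₂
  | cons e es ih =>
    intro l hl u v
    have hl' : ∀ u, num u < (mergeLabels num l e).length := by simpa [mergeLabels] using hl
    rw [List.foldl_cons, ih hl']
    constructor
    · intro h
      induction h with
      | rel a b h =>
        rcases h with h | h
        · rw [labelOf_mergeLabels e (hl a), labelOf_mergeLabels e (hl b)] at h
          have key : ∀ c, (labelOf num l c = labelOf num l e.1 ∨
              labelOf num l c = labelOf num l e.2) →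
              EqvGen (fun a b => labelOf num l a = labelOf num l b ∨ (a, b) ∈ e :: es) c e.1 := by
            rintro c (hc | hc)
            · exact .rel _ _ (Or.inl hc)
            · exact .trans _ e.2 _ (.rel _ _ (Or.inl hc))
                (.symm _ _ (.rel _ _ (Or.inr List.mem_cons_self)))
          have hmin := min_choice (labelOf num l e.1) (labelOf num l e.2)
          split_ifs at h with h₁ h₂ h₂
          · exact .trans _ _ _ (key a h₁) (.symm _ _ (key b h₂))
          · exact absurd (by rcases hmin with h' | h' <;> simp [← h, h']) h₂
          · exact absurd (by rcases hmin with h' | h' <;> simp [h, h']) h₁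
          · exact .rel _ _ (Or.inl h)
        · exact .rel _ _ (Or.inr (List.mem_cons_of_mem _ h))
      | refl => exact .refl _
      | symm _ _ _ h => exact .symm _ _ h
      | trans _ _ _ _ _ h₁ h₂ => exact .trans _ _ _ h₁ h₂
    · intro h
      induction h with
      | rel a b h =>
        rcases h with h | h
        · refine .rel _ _ (Or.inl ?_)
          rw [labelOf_mergeLabels e (hl a), labelOf_mergeLabels e (hl b), h]
        · rcases List.mem_cons.1 h with rfl | h
          · refine .rel _ _ (Or.inl ?_)
            rw [labelOf_mergeLabels _ (hl a), labelOf_mergeLabels _ (hl b)]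
            simp
          · exact .rel _ _ (Or.inr h)
      | refl => exact .refl _
      | symm _ _ _ h => exact .symm _ _ h
      | trans _ _ _ _ _ h₁ h₂ => exact .trans _ _ _ h₁ h₂

theorem labelOf_foldl_range_eq_iff (hnum : Function.Injective num) {n : ℕ} (hn : ∀ u, num u < n)
    (es : List (W × W)) (u v : W) :
    (labelOf num (es.foldl (mergeLabels num) (List.range n)) u =
      labelOf num (es.foldl (mergeLabels num) (List.range n)) v ↔
      EqvGen (fun a b => (a, b) ∈ es) u v) := by
  have h0 : ∀ a, labelOf num (List.range n) a = num a := fun a => by simp [labelOf, hn a]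
  rw [labelOf_foldl_eq_iff es (by simpa using hn)]
  simp only [h0, hnum.eq_iff]
  constructor
  · intro h
    induction h with
    | rel a b h =>
      rcases h with rfl | h
      · exact .refl _
      · exact .rel _ _ h
    | refl => exact .refl _
    | symm _ _ _ h => exact .symm _ _ h
    | trans _ _ _ _ _ h₁ h₂ => exact .trans _ _ _ h₁ h₂
  · exact fun h => h.mono fun _ _ => Or.inr

end Labels

section Glue

variable {B N Z : Type*}

/-- Identification of the images under `ψ` of boundary nodes that carry equal labels. -/
def BoundaryJoined (ψ : B → Z) (k : B → ℕ) (z z' : Z) : Prop :=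
  ∃ i j, k i = k j ∧ ψ i = z ∧ ψ j = z'

/-- If a graph on boundary nodes `B` and inner nodes `N`, whose components are told apart by the
labels `L`, is attached to `Z` along `ψ`, then the classes are those of `Z` with the joined
boundary nodes identified, and the components that avoid the boundary. -/
theorem card_quot_glue [Finite Z] [Fintype B] [Fintype N] (r : B ⊕ N → B ⊕ N → Prop)
    (L : B ⊕ N → ℕ) (hL : ∀ u v, L u = L v ↔ EqvGen r u v) (ψ : B → Z) :
    Nat.card (Quot (Relation.Map r (Sum.map ψ id) (Sum.map ψ (id : N → N)))) =
      (Finset.univ.image (fun n => L (Sum.inr n)) \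
        Finset.univ.image (fun i => L (Sum.inl i))).card +
      Nat.card (Quot (BoundaryJoined ψ fun i => L (Sum.inl i))) := by
  classical
  set loops := Finset.univ.image (fun n => L (Sum.inr n)) \
        Finset.univ.image (fun i => L (Sum.inl i)) with hloops
  have hmem : ∀ l, l ∈ loops ↔ (∃ n, L (Sum.inr n) = l) ∧ ∀ i, L (Sum.inl i) ≠ l := by
    simp [hloops]
  set ρ := Relation.Map r (Sum.map ψ id) (Sum.map ψ (id : N → N))
  set J := BoundaryJoined ψ fun i => L (Sum.inl i)
  have hsound : ∀ u v, L u = L v →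
      Quot.mk ρ (Sum.map ψ id u) = Quot.mk ρ (Sum.map ψ id v) := by
    intro u v h
    rw [hL] at h
    induction h with
    | rel a b h => exact Quot.sound ⟨a, b, h, rfl, rfl⟩
    | refl => rfl
    | symm _ _ _ h => exact h.symm
    | trans _ _ _ _ _ h₁ h₂ => exact h₁.trans h₂
  let inner : N → loops ⊕ Quot J := fun n =>
    if h : ∃ i, L (Sum.inl i) = L (Sum.inr n) then Sum.inr (Quot.mk J (ψ h.choose))
    else Sum.inl ⟨L (Sum.inr n), (hmem _).2 ⟨⟨n, rfl⟩, not_exists.1 h⟩⟩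
  let f : Z ⊕ N → loops ⊕ Quot J := Sum.elim (fun z => Sum.inr (Quot.mk J z)) inner
  have inner_of : ∀ n i, L (Sum.inl i) = L (Sum.inr n) → inner n = Sum.inr (Quot.mk J (ψ i)) := by
    intro n i hi
    have h : ∃ i, L (Sum.inl i) = L (Sum.inr n) := ⟨i, hi⟩
    simp only [inner, dif_pos h]
    exact congrArg Sum.inr (Quot.sound ⟨_, _, h.choose_spec.trans hi.symm, rfl, rfl⟩)
  have hf : ∀ u v, L u = L v → f (Sum.map ψ id u) = f (Sum.map ψ id v) := by
    rintro (i | n) (j | n') h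
    · exact congrArg Sum.inr (Quot.sound ⟨i, j, h, rfl, rfl⟩)
    · exact (inner_of n' i h).symm
    · exact inner_of n j h.symm
    · change inner n = inner n'
      by_cases h' : ∃ i, L (Sum.inl i) = L (Sum.inr n)
      · obtain ⟨i, hi⟩ := h'
        rw [inner_of n i hi, inner_of n' i (hi.trans h)]
      · have h'' : ¬ ∃ i, L (Sum.inl i) = L (Sum.inr n') := by rwa [← h]
        simp only [inner, dif_neg h', dif_neg h'']
        exact congrArg Sum.inl (Subtype.ext h)
  let e : Quot ρ ≃ loops ⊕ Quot J :=
    { toFun := Quot.lift f (by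
        rintro _ _ ⟨u, v, h, rfl, rfl⟩
        exact hf u v ((hL u v).2 (.rel _ _ h)))
      invFun := Sum.elim (fun l => Quot.mk ρ (Sum.inr ((hmem _).1 l.2).1.choose))
        (Quot.lift (fun z => Quot.mk ρ (Sum.inl z)) (by
          rintro _ _ ⟨i, j, h, rfl, rfl⟩
          exact hsound (Sum.inl i) (Sum.inl j) h))
      left_inv := by
        rintro ⟨z | n⟩
        · rfl
        · change Sum.elim _ _ (inner n) = _
          by_cases h' : ∃ i, L (Sum.inl i) = L (Sum.inr n)
          · obtain ⟨i, hi⟩ := h'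
            rw [inner_of n i hi]
            exact hsound (Sum.inl i) (Sum.inr n) hi
          · simp only [inner, dif_neg h', Sum.elim_inl]
            generalize_proofs p
            exact hsound (Sum.inr _) (Sum.inr n) p.choose_spec
      right_inv := by
        rintro (⟨l, hl⟩ | z)
        · have hl' := (hmem l).1 hl
          change inner hl'.1.choose = _
          have h' : ¬ ∃ i, L (Sum.inl i) = L (Sum.inr hl'.1.choose) := by
            rw [hl'.1.choose_spec]
            exact fun ⟨i, hi⟩ => hl'.2 i hi
          simp only [inner, dif_neg h']
          exact congrArg Sum.inl (Subtype.ext hl'.1.choose_spec)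
        · induction z using Quot.ind
          rfl }
  rw [Nat.card_congr e, Nat.card_sum]
  simp

end Glue

instance : Fintype Strand := ⟨{.upper, .lower}, fun a => by cases a <;> simp⟩

/-! ### Cutting a smoothed diagram along a circle -/

/-- The curves of a smoothed diagram, in a set `W` of edges: `emb v` is the edge that arrives at
the vertex `v` and `next v` is the edge that leaves it. Two edges are related if a marked point
or the smoothing of a site joins them. -/
inductive SmoothedAdj {S P W : Type} (emb next : S × Strand ⊕ P → W) (σ : S → Smoothing) :
    W → W → Prop
  | point (p : P) : SmoothedAdj emb next σ (emb (Sum.inr p)) (next (Sum.inr p))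
  | A_left (s : S) (h : σ s = .A) :
      SmoothedAdj emb next σ (emb (Sum.inl (s, .lower))) (next (Sum.inl (s, .upper)))
  | A_right (s : S) (h : σ s = .A) :
      SmoothedAdj emb next σ (emb (Sum.inl (s, .upper))) (next (Sum.inl (s, .lower)))
  | B_sink (s : S) (h : σ s = .B) :
      SmoothedAdj emb next σ (emb (Sum.inl (s, .lower))) (emb (Sum.inl (s, .upper)))
  | B_source (s : S) (h : σ s = .B) :
      SmoothedAdj emb next σ (next (Sum.inl (s, .lower))) (next (Sum.inl (s, .upper)))

/-- Maps of sites, points and edges that respect the joining edges up to the kernel of `F` carry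
adjacent edges to edges with the same value. -/
theorem SmoothedAdj.map_eq {S P W S' P' W' Q : Type} {emb next : S × Strand ⊕ P → W}
    {σ : S → Smoothing} {emb' next' : S' × Strand ⊕ P' → W'} {σ' : S' → Smoothing}
    (f : S → S') (g : P → P') (hσ : ∀ s, σ' (f s) = σ s) (F : W → Q) (G : W' → Q)
    (hG : ∀ a b, SmoothedAdj emb' next' σ' a b → G a = G b)
    (hemb : ∀ v, F (emb v) = G (emb' (Sum.map (fun p => (f p.1, p.2)) g v)))
    (hnext : ∀ v, F (next v) = G (next' (Sum.map (fun p => (f p.1, p.2)) g v)))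
    {a b : W} (h : SmoothedAdj emb next σ a b) : F a = F b := by
  cases h with
  | point p => rw [hemb, hnext]; exact hG _ _ (.point _)
  | A_left s h => rw [hemb, hnext]; exact hG _ _ (.A_left _ ((hσ s).trans h))
  | A_right s h => rw [hemb, hnext]; exact hG _ _ (.A_right _ ((hσ s).trans h))
  | B_sink s h => rw [hemb, hemb]; exact hG _ _ (.B_sink _ ((hσ s).trans h))
  | B_source s h => rw [hnext, hnext]; exact hG _ _ (.B_source _ ((hσ s).trans h))

theorem TraceDiagram.adjacent_iff_smoothedAdj (D : TraceDiagram) (σ : D.Site → Smoothing)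
    (hσ : ∀ s, D.kind s = .trace (σ s)) (a b : D.Vertex) :
    D.Adjacent a b ↔ SmoothedAdj id D.next σ a b := by
  constructor
  · intro h
    cases h with
    | point p => exact .point p
    | crossing s _ h => simp [hσ] at h
    | traceA_left s h => exact .A_left s (by simpa [hσ] using h)
    | traceA_right s h => exact .A_right s (by simpa [hσ] using h)
    | traceB_sink s h => exact .B_sink s (by simpa [hσ] using h)
    | traceB_source s h => exact .B_source s (by simpa [hσ] using h)
  · intro h
    cases h with
    | point p => exact .point p
    | A_left s h => exact .traceA_left s (by rw [hσ, h])
    | A_right s h => exact .traceA_right s (by rw [hσ, h])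
    | B_sink s h => exact .traceB_sink s (by rw [hσ, h])
    | B_source s h => exact .traceB_source s (by rw [hσ, h])

/-- How `m` arcs run through the vertices of a disc tangle with sites `S` and points `P`: the
first stop of each arc and the stop after each vertex. A stop is a vertex of the tangle, or, at
the end of the `i`-th arc, the element `i` of `Fin m`. -/
structure Course (m : ℕ) (S P : Type) where
  first : Fin m → Fin m ⊕ (S × Strand ⊕ P)
  succ : S × Strand ⊕ P → Fin m ⊕ (S × Strand ⊕ P)

/-- The edges that meet a disc: for each arc the edge that enters the disc and the edge that
leaves it, and the edges that arrive at the vertices in the disc. (The entering edge of an arc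
appears once more, at its first stop.) -/
abbrev TangleNode (m : ℕ) (S P : Type) : Type := (Fin m ⊕ Fin m) ⊕ (S × Strand ⊕ P)

namespace Course

variable {m : ℕ} {S P : Type}

/-- The edge that arrives at a stop. -/
def node : Fin m ⊕ (S × Strand ⊕ P) → TangleNode m S P :=
  Sum.map Sum.inr id

/-- The joining of edges inside a disc by the smoothing `σ`. -/
def Adj (c : Course m S P) (σ : S → Smoothing) (u v : TangleNode m S P) : Prop :=
  (∃ i, u = Sum.inl (Sum.inl i) ∧ v = node (c.first i)) ∨
    SmoothedAdj Sum.inr (node ∘ c.succ) σ u v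

/-- The course describes the strands of an inserted tangle. -/
structure Describes (c : Course m S P) {O : TraceDiagram} {port : Fin m ↪ O.Vertex}
    {sg : S → ℤˣ} {arc : Fin m → List (S × Strand ⊕ P)} {D : TraceDiagram}
    (I : Insertion O port ⟨S, P, sg, arc⟩ D) : Prop where
  first : ∀ i, D.next (I.outside (port i)) =
    Sum.elim (fun j => I.outside (O.next (port j))) I.inside (c.first i)
  succ : ∀ n, D.next (I.inside n) =
    Sum.elim (fun j => I.outside (O.next (port j))) I.inside (c.succ n)

end Course

namespace Insertion

variable {m : ℕ} {O : TraceDiagram} {port : Fin m ↪ O.Vertex}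

open Classical in
variable (O port) in
/-- Outside of the disc, the edge that leaves a vertex: an edge that arrives at an outside
vertex, or the edge that leaves the port `i` and enters the disc. -/
noncomputable def leave (v : O.Vertex) : O.Vertex ⊕ Fin m :=
  if h : ∃ i, port i = v then Sum.inr h.choose else Sum.inl (O.next v)

theorem leave_port (i : Fin m) : leave O port (port i) = Sum.inr i := by
  have h : ∃ j, port j = port i := ⟨i, rfl⟩
  rw [leave, dif_pos h, port.injective h.choose_spec]

theorem leave_of_notMem {v : O.Vertex} (h : v ∉ Set.range port) :
    leave O port v = Sum.inl (O.next v) := dif_neg h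

variable (port) in
/-- The pieces of curves outside the disc. -/
abbrev OuterClass (τ : O.Site → Smoothing) : Type :=
  Quot (SmoothedAdj (Sum.inl : O.Vertex → O.Vertex ⊕ Fin m) (leave O port) τ)

instance (τ : O.Site → Smoothing) : Finite (OuterClass port τ) :=
  inferInstanceAs (Finite (Quot _))

variable (port) in
/-- The pieces of curves that run into the disc and out of it along the arcs. -/
def boundary (τ : O.Site → Smoothing) : Fin m ⊕ Fin m → OuterClass port τ
  | Sum.inl i => Quot.mk _ (Sum.inr i)
  | Sum.inr i => Quot.mk _ (Sum.inl (O.next (port i)))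

variable {S P : Type} {sg : S → ℤˣ} {arc : Fin m → List (S × Strand ⊕ P)} {D : TraceDiagram}
  (I : Insertion O port ⟨S, P, sg, arc⟩ D)

/-- The vertices of the diagram are the outside vertices and those of the tangle. -/
def vertexEquiv : O.Vertex ⊕ (S × Strand ⊕ P) ≃ D.Vertex :=
  (Equiv.sumSumSumComm _ _ _ _).trans <|
    Equiv.sumCongr ((Equiv.sumProdDistrib _ _ _).symm.trans (Equiv.prodCongr I.site (Equiv.refl _)))
      I.point

theorem vertexEquiv_inl (v : O.Vertex) : I.vertexEquiv (Sum.inl v) = I.outside v := by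
  rw [I.outside_eq]
  rcases v with ⟨s, a⟩ | p <;> rfl

theorem vertexEquiv_inr (n : S × Strand ⊕ P) : I.vertexEquiv (Sum.inr n) = I.inside n := by
  rw [I.inside_eq]
  rcases n with ⟨s, a⟩ | p <;> rfl

/-- The curves of a smoothed diagram are obtained by gluing the curves inside a disc to the
pieces of curves outside of it. -/
theorem card_quot_smoothedAdj {c : Course m S P} (hc : c.Describes I) (τ : O.Site → Smoothing)
    (ρ : S → Smoothing) :
    Nat.card (Quot (SmoothedAdj id D.next (Sum.elim τ ρ ∘ I.site.symm))) =
      Nat.card (Quot (Relation.Map (c.Adj ρ) (Sum.map (boundary port τ) id)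
        (Sum.map (boundary port τ) (id : S × Strand ⊕ P → _)))) := by
  set σ := Sum.elim τ ρ ∘ I.site.symm
  set r := Relation.Map (c.Adj ρ) (Sum.map (boundary port τ) id)
        (Sum.map (boundary port τ) (id : S × Strand ⊕ P → _))
  have hsound : ∀ {u v}, c.Adj ρ u v → Quot.mk r (Sum.map (boundary port τ) id u) =
      Quot.mk r (Sum.map (boundary port τ) id v) := fun h => Quot.sound ⟨_, _, h, rfl, rfl⟩
  let H : D.Vertex → Quot r := fun d => Sum.elim
    (fun v => Quot.mk r (Sum.inl (Quot.mk _ (Sum.inl v)))) (fun n => Quot.mk r (Sum.inr n))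
    (I.vertexEquiv.symm d)
  have H_out : ∀ v, H (I.outside v) = Quot.mk r (Sum.inl (Quot.mk _ (Sum.inl v))) := fun v => by
    simp only [H, ← I.vertexEquiv_inl, Equiv.symm_apply_apply, Sum.elim_inl]
  have H_in : ∀ n, H (I.inside n) = Quot.mk r (Sum.inr n) := fun v => by
    simp only [H, ← I.vertexEquiv_inr, Equiv.symm_apply_apply, Sum.elim_inr]
  have H_node : ∀ t, H (Sum.elim (fun j => I.outside (O.next (port j))) I.inside t) =
      Quot.mk r (Sum.map (boundary port τ) id (Course.node t)) := by
    rintro (j | n)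
    · exact H_out _
    · exact H_in _
  have H_next_out : ∀ v, H (D.next (I.outside v)) =
      Quot.mk r (Sum.inl (Quot.mk _ (leave O port v))) := by
    intro v
    by_cases hv : v ∈ Set.range port
    · obtain ⟨i, rfl⟩ := hv
      rw [hc.first, H_node, leave_port]
      exact (hsound (Or.inl ⟨i, rfl, rfl⟩)).symm
    · rw [I.next_outside v hv, H_out, leave_of_notMem hv]
  have H_next_in : ∀ n, H (D.next (I.inside n)) =
      Quot.mk r (Sum.map (boundary port τ) id (Course.node (c.succ n))) := fun n => by
    rw [hc.succ, H_node]
  have site_out : ∀ s a, (Sum.inl (I.site (Sum.inl s), a) : D.Vertex) =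
      I.outside (Sum.inl (s, a)) := fun s a => by rw [I.outside_eq]; rfl
  have site_in : ∀ s a, (Sum.inl (I.site (Sum.inr s), a) : D.Vertex) =
      I.inside (Sum.inl (s, a)) := fun s a => by rw [I.inside_eq]; rfl
  have point_out : ∀ p, (Sum.inr (I.point (Sum.inl p)) : D.Vertex) = I.outside (Sum.inr p) :=
    fun p => by rw [I.outside_eq]; rfl
  have point_in : ∀ p, (Sum.inr (I.point (Sum.inr p)) : D.Vertex) = I.inside (Sum.inr p) :=
    fun p => by rw [I.inside_eq]; rfl
  have σ_out : ∀ s, σ (I.site (Sum.inl s)) = τ s := fun s => by simp [σ]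
  have σ_in : ∀ s, σ (I.site (Sum.inr s)) = ρ s := fun s => by simp [σ]
  have hH : ∀ a b, SmoothedAdj id D.next σ a b → H a = H b := by
    have glue_out : ∀ {a b}, SmoothedAdj Sum.inl (leave O port) τ a b →
        Quot.mk r (Sum.inl (Quot.mk _ a)) = Quot.mk r (Sum.inl (Quot.mk _ b)) :=
      fun h => congrArg (fun z => Quot.mk r (Sum.inl z)) (Quot.sound h)
    intro a b h
    cases h with
    | point p =>
      obtain ⟨p | p, rfl⟩ := I.point.surjective p
      · rw [id, point_out, H_out, H_next_out]
        exact glue_out (.point p)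
      · rw [id, point_in, H_in, H_next_in]
        exact hsound (Or.inr (.point p))
    | A_left s h =>
      obtain ⟨s | s, rfl⟩ := I.site.surjective s
      · rw [id, site_out, site_out, H_out, H_next_out]
        exact glue_out (.A_left s ((σ_out s).symm.trans h))
      · rw [id, site_in, site_in, H_in, H_next_in]
        exact hsound (Or.inr (.A_left s ((σ_in s).symm.trans h)))
    | A_right s h =>
      obtain ⟨s | s, rfl⟩ := I.site.surjective s
      · rw [id, site_out, site_out, H_out, H_next_out]
        exact glue_out (.A_right s ((σ_out s).symm.trans h))
      · rw [id, site_in, site_in, H_in, H_next_in]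
        exact hsound (Or.inr (.A_right s ((σ_in s).symm.trans h)))
    | B_sink s h =>
      obtain ⟨s | s, rfl⟩ := I.site.surjective s
      · rw [id, id, site_out, site_out, H_out, H_out]
        exact glue_out (.B_sink s ((σ_out s).symm.trans h))
      · rw [id, id, site_in, site_in, H_in, H_in]
        exact hsound (Or.inr (.B_sink s ((σ_in s).symm.trans h)))
    | B_source s h =>
      obtain ⟨s | s, rfl⟩ := I.site.surjective s
      · rw [site_out, site_out, H_next_out, H_next_out]
        exact glue_out (.B_source s ((σ_out s).symm.trans h))
      · rw [site_in, site_in, H_next_in, H_next_in]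
        exact hsound (Or.inr (.B_source s ((σ_in s).symm.trans h)))
  set δ := SmoothedAdj id D.next σ
  let K₀ : O.Vertex ⊕ Fin m → Quot δ :=
    Sum.elim (fun v => Quot.mk δ (I.outside v)) (fun i => Quot.mk δ (D.next (I.outside (port i))))
  have K₀_leave : ∀ v, K₀ (leave O port v) = Quot.mk δ (D.next (I.outside v)) := by
    intro v
    by_cases hv : v ∈ Set.range port
    · obtain ⟨i, rfl⟩ := hv
      rw [leave_port]
      rfl
    · rw [leave_of_notMem hv, I.next_outside v hv]
      rfl
  let K₁ : OuterClass port τ ⊕ (S × Strand ⊕ P) → Quot δ := Sum.elim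
    (Quot.lift K₀ fun a b h => h.map_eq (fun s => I.site (Sum.inl s)) (fun p => I.point (Sum.inl p))
      σ_out K₀ (Quot.mk δ) (fun _ _ => Quot.sound)
      (fun v => by rw [I.outside_eq.symm]; rfl)
      (fun v => by rw [K₀_leave, I.outside_eq.symm]))
    (fun n => Quot.mk δ (I.inside n))
  have K₁_node : ∀ t, K₁ (Sum.map (boundary port τ) id (Course.node t)) =
      Quot.mk δ (Sum.elim (fun j => I.outside (O.next (port j))) I.inside t) := by
    rintro (j | n) <;> rfl
  have hK₁ : ∀ u v, c.Adj ρ u v →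
      K₁ (Sum.map (boundary port τ) id u) = K₁ (Sum.map (boundary port τ) id v) := by
    rintro u v (⟨i, rfl, rfl⟩ | h)
    · rw [K₁_node, ← hc.first]
      rfl
    · refine h.map_eq (fun s => I.site (Sum.inr s)) (fun p => I.point (Sum.inr p))
        σ_in (fun u => K₁ (Sum.map (boundary port τ) id u)) (Quot.mk δ) (fun _ _ => Quot.sound)
        (fun v => ?_) (fun v => ?_)
      · rw [I.inside_eq.symm]
        rfl
      · rw [I.inside_eq.symm, hc.succ, Function.comp_apply, K₁_node]
  have hr : ∀ a b, r a b → K₁ a = K₁ b := by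
    rintro _ _ ⟨u, v, h, rfl, rfl⟩
    exact hK₁ u v h
  exact Nat.card_congr
    { toFun := Quot.lift H hH
      invFun := Quot.lift K₁ hr
      left_inv := by
        rintro ⟨d⟩
        obtain ⟨v | n, rfl⟩ := I.vertexEquiv.surjective d
        · rw [vertexEquiv_inl]
          exact congrArg (Quot.lift K₁ hr) (H_out v)
        · rw [vertexEquiv_inr]
          exact congrArg (Quot.lift K₁ hr) (H_in n)
      right_inv := by
        rintro ⟨⟨⟨v | i⟩⟩ | n⟩
        · exact H_out v
        · exact (H_next_out (port i)).trans (by rw [leave_port])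
        · exact H_in n }

end Insertion

/-! ### The bracket as a state sum -/

namespace BiquandleBracket

variable {X : Type*} [Biquandle X] {R : Type*} [CommRing R] (β : BiquandleBracket X R)

/-- The weight of a smoothing `t` at the site `s`: the skein coefficient if `s` is a crossing; at
a trace only the smoothing of the type of the trace is allowed. -/
def siteWeight (D : ColoredTraceDiagram X) (s : D.Site) (t : Smoothing) : R :=
  match D.kind s with
  | .crossing => β.coeff D s t
  | .trace t' => if t = t' then 1 else 0

theorem siteWeight_crossing {D : ColoredTraceDiagram X} {s : D.Site} (h : D.kind s = .crossing)
    (t : Smoothing) : β.siteWeight D s t = β.coeff D s t := by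
  simp [siteWeight, h]

theorem siteWeight_trace {D : ColoredTraceDiagram X} {s : D.Site} {t' : Smoothing}
    (h : D.kind s = .trace t') (t : Smoothing) :
    β.siteWeight D s t = if t = t' then 1 else 0 := by
  simp [siteWeight, h]

/-- The state sum of a trace diagram, over the states that keep the traces. -/
noncomputable def traceBracket (D : ColoredTraceDiagram X) : R :=
  (β.writheFactor D : R) * ∑ σ : D.Site → Smoothing,
    (∏ s, β.siteWeight D s (σ s)) * β.δ ^ (D.smoothAll σ).componentCount

theorem traceBracket_eq_stateSum {L : ColoredTraceDiagram X} (hL : L.IsLinkDiagram) :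
    β.traceBracket L = β.stateSum L := by
  unfold traceBracket stateSum
  congr 1
  refine Finset.sum_congr rfl fun σ _ => ?_
  congr 1
  exact Finset.prod_congr rfl fun s _ => β.siteWeight_crossing (hL s) _

theorem siteWeight_smooth_self (D : ColoredTraceDiagram X) (s : D.Site) (t t' : Smoothing) :
    β.siteWeight (D.smooth s t) s t' = if t' = t then 1 else 0 :=
  β.siteWeight_trace (D := D.smooth s t) (Function.update_self ..) t'

theorem siteWeight_smooth_of_ne (D : ColoredTraceDiagram X) {s s' : D.Site} (h : s' ≠ s)
    (t t' : Smoothing) : β.siteWeight (D.smooth s t) s' t' = β.siteWeight D s' t' := by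
  have hk : (D.smooth s t).kind s' = D.kind s' := Function.update_of_ne h ..
  cases hD : D.kind s' with
  | crossing =>
    rw [β.siteWeight_crossing (hk.trans hD), β.siteWeight_crossing hD]
    cases t' <;> rfl
  | trace t₀ => rw [β.siteWeight_trace (hk.trans hD), β.siteWeight_trace hD]

theorem isTraceBracket_traceBracket : β.IsTraceBracket β.traceBracket where
  skein D s hs := by
    have split : ∀ σ : D.Site → Smoothing, ∏ s', β.siteWeight D s' (σ s') =
        β.coeff D s .A * ∏ s', β.siteWeight (D.smooth s .A) s' (σ s') +
        β.coeff D s .B * ∏ s', β.siteWeight (D.smooth s .B) s' (σ s') := by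
      intro σ
      have hprod : ∀ t, ∏ s', β.siteWeight (D.smooth s t) s' (σ s') =
          (if σ s = t then 1 else 0) * ∏ s' ∈ Finset.univ.erase s, β.siteWeight D s' (σ s') := by
        intro t
        refine (Finset.mul_prod_erase Finset.univ
          (fun s' : D.Site => β.siteWeight (D.smooth s t) s' (σ s'))
          (Finset.mem_univ s)).symm.trans ?_
        rw [siteWeight_smooth_self]
        congr 1
        exact Finset.prod_congr rfl fun s' h =>
          siteWeight_smooth_of_ne β D (Finset.ne_of_mem_erase h) ..
      rw [hprod, hprod, ← Finset.mul_prod_erase _ _ (Finset.mem_univ s), β.siteWeight_crossing hs]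
      cases σ s <;> simp
    have key : ∀ t, β.traceBracket (D.smooth s t) = (β.writheFactor D : R) *
        ∑ σ : D.Site → Smoothing, (∏ s', β.siteWeight (D.smooth s t) s' (σ s')) *
          β.δ ^ (D.smoothAll σ).componentCount := fun t => rfl
    rw [key, key, traceBracket]
    simp only [split, add_mul, Finset.sum_add_distrib, mul_assoc, ← Finset.mul_sum]
    ring
  no_crossing D hD := by
    have htype : ∀ s, ∃ t, D.kind s = .trace t := by
      intro s
      cases h : D.kind s with
      | crossing => exact absurd h (hD s)
      | trace t => exact ⟨t, rfl⟩
    choose σ hσ using htype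
    have hsmooth : D.smoothAll σ = D := by
      have : (fun s => SiteKind.trace (σ s)) = D.kind := funext fun s => (hσ s).symm
      unfold ColoredTraceDiagram.smoothAll
      rw [this]
      rfl
    rw [traceBracket, Finset.sum_eq_single σ]
    · rw [hsmooth, Finset.prod_eq_one, one_mul]
      intro s _
      rw [β.siteWeight_trace (hσ s), if_pos rfl]
    · intro τ _ hτ
      obtain ⟨s, hs⟩ := Function.ne_iff.1 hτ
      rw [Finset.prod_eq_zero (Finset.mem_univ s), zero_mul]
      rw [β.siteWeight_trace (hσ s), if_neg hs]
    · simp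

/-- The rules determine the bracket, by induction on the number of crossings. -/
theorem IsTraceBracket.eq {β : BiquandleBracket X R} {br br' : ColoredTraceDiagram X → R}
    (h : β.IsTraceBracket br) (h' : β.IsTraceBracket br') : br = br' := by
  classical
  funext D
  induction hn : (Finset.univ.filter fun s => D.kind s = .crossing).card using
    Nat.strong_induction_on generalizing D with
  | _ n ih =>
    by_cases hD : ∀ s, D.kind s ≠ .crossing
    · rw [h.no_crossing D hD, h'.no_crossing D hD]
    · push Not at hD
      obtain ⟨s, hs⟩ := hD
      have hlt : ∀ t, (Finset.univ.filter fun s' : D.Site =>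
          Function.update D.kind s (.trace t) s' = .crossing).card < n := by
        intro t
        rw [← hn]
        refine Finset.card_lt_card
          (Finset.ssubset_iff_of_subset ?_ |>.2 ⟨s, by simpa using hs, by simp⟩)
        intro s' hs'
        rw [Finset.mem_filter] at hs' ⊢
        refine ⟨hs'.1, ?_⟩
        by_cases hss : s' = s
        · exact hss ▸ hs
        · rw [← hs'.2, Function.update_of_ne hss]
      have ih' : ∀ t, br (D.smooth s t) = br' (D.smooth s t) := fun t => ih _ (hlt t) _ rfl
      rw [h.skein D s hs, h'.skein D s hs, ih', ih']

theorem writheFactor_eq (D : ColoredTraceDiagram X) :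
    β.writheFactor D = β.w ^ (-∑ s, (D.sign s : ℤ)) := by
  have h : ∀ e : ℤˣ, -(e : ℤ) = (if e = -1 then 1 else 0) - (if e = 1 then 1 else 0) := by decide
  rw [writheFactor, ← Finset.sum_neg_distrib]
  simp only [h, TraceDiagram.numNeg, TraceDiagram.numPos, Finset.card_filter,
    Finset.sum_sub_distrib]
  push_cast
  rfl

end BiquandleBracket

/-! ### Evaluation of smoothed tangles -/

instance : FinEnum Strand := FinEnum.ofList [.upper, .lower] fun a => by cases a <;> simp

namespace Course

variable {m : ℕ} {S P : Type} [FinEnum S] [FinEnum P] (c : Course m S P)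

/-- The pairs of edges that are joined inside the disc by the smoothing `ρ`. -/
def edges (ρ : S → Smoothing) : List (TangleNode m S P × TangleNode m S P) :=
  ((List.finRange m).map fun i => (Sum.inl (Sum.inl i), node (c.first i))) ++
  ((FinEnum.toList P).map fun p => (Sum.inr (Sum.inr p), node (c.succ (Sum.inr p)))) ++
  (FinEnum.toList S).flatMap fun s =>
    let l : S × Strand ⊕ P := Sum.inl (s, .lower)
    let u : S × Strand ⊕ P := Sum.inl (s, .upper)
    match ρ s with
    | .A => [(Sum.inr l, node (c.succ u)), (Sum.inr u, node (c.succ l))]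
    | .B => [(Sum.inr l, Sum.inr u), (node (c.succ l), node (c.succ u))]

theorem mem_edges (ρ : S → Smoothing) (a b : TangleNode m S P) :
    (a, b) ∈ c.edges ρ ↔ c.Adj ρ a b := by
  simp only [edges, Adj, List.mem_append, List.mem_map, List.mem_finRange, true_and,
    FinEnum.mem_toList, List.mem_flatMap, Prod.mk.injEq, or_assoc]
  refine or_congr (exists_congr fun i => ⟨fun h => ⟨h.1.symm, h.2.symm⟩,
    fun h => ⟨h.1.symm, h.2.symm⟩⟩) ⟨?_, ?_⟩
  · rintro (⟨p, rfl, rfl⟩ | ⟨s, h⟩)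
    · exact .point p
    · cases hs : ρ s <;> simp only [hs, List.mem_cons, List.not_mem_nil, or_false,
        Prod.mk.injEq] at h <;> rcases h with ⟨rfl, rfl⟩ | ⟨rfl, rfl⟩
      · exact .A_left s hs
      · exact .A_right s hs
      · exact .B_sink s hs
      · exact .B_source s hs
  · intro h
    cases h with
    | point p => exact Or.inl ⟨p, rfl, rfl⟩
    | A_left s h => exact Or.inr ⟨s, by simp [h]⟩
    | A_right s h => exact Or.inr ⟨s, by simp [h]⟩
    | B_sink s h => exact Or.inr ⟨s, by simp [h]⟩
    | B_source s h => exact Or.inr ⟨s, by simp [h]⟩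

/-- Labels that tell the components inside the disc apart. -/
def label (ρ : S → Smoothing) : TangleNode m S P → ℕ :=
  labelOf (fun u => (FinEnum.equiv u : ℕ)) ((c.edges ρ).foldl
    (mergeLabels fun u => (FinEnum.equiv u : ℕ)) (List.range (FinEnum.card (TangleNode m S P))))

theorem label_eq_iff (ρ : S → Smoothing) (u v : TangleNode m S P) :
    c.label ρ u = c.label ρ v ↔ EqvGen (c.Adj ρ) u v := by
  rw [label, labelOf_foldl_range_eq_iff (fun a b h => FinEnum.equiv.injective (Fin.ext h))
    (fun u => (FinEnum.equiv u).2)]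
  simp only [mem_edges]

/-- The labels of the edges that enter and leave the disc: two of these edges are joined inside
the disc if and only if their labels agree. -/
def pattern (ρ : S → Smoothing) (b : Fin m ⊕ Fin m) : ℕ := c.label ρ (Sum.inl b)

/-- The number of closed curves inside the disc. -/
def loops (ρ : S → Smoothing) : ℕ :=
  (Finset.univ.image (fun n => c.label ρ (Sum.inr n)) \
    Finset.univ.image (fun b => c.label ρ (Sum.inl b))).card

theorem card_quot_map_adj {Z : Type} [Finite Z] (ρ : S → Smoothing) (ψ : Fin m ⊕ Fin m → Z) :
    Nat.card (Quot (Relation.Map (c.Adj ρ) (Sum.map ψ id)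
      (Sum.map ψ (id : S × Strand ⊕ P → _)))) =
      c.loops ρ + Nat.card (Quot (BoundaryJoined ψ (c.pattern ρ))) :=
  card_quot_glue _ _ (c.label_eq_iff ρ) ψ

end Course

/-! ### Colors at crossings -/

section Colors
variable {X : Type*} [Biquandle X]

theorem Biquandle.under_injective {x y z : X} (h : underOp x z = underOp y z) : x = y :=
  (bijective_under z).1 h

theorem Biquandle.over_injective {x y z : X} (h : overOp x z = overOp y z) : x = y :=
  (bijective_over z).1 h

theorem Biquandle.sideways_injective {x y x' y' : X} (h₁ : overOp y x = overOp y' x')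
    (h₂ : underOp x y = underOp x' y') : x = x' ∧ y = y' :=
  Prod.mk.inj ((bijective_sideways (X := X)).1 (a₁ := (x, y)) (a₂ := (x', y')) (Prod.ext h₁ h₂))

/-- The four edges at a crossing of sign `ε` with the labels `x`, `y` are colored by
`ui` (under, incoming), `uo` (under, outgoing), `oi` (over, incoming), `oo` (over, outgoing). -/
def CrossingColors (ε : ℤˣ) (ui uo oi oo x y : X) : Prop :=
  if ε = 1 then ui = x ∧ uo = underOp x y ∧ oi = overOp y x ∧ oo = y
  else ui = underOp x y ∧ uo = x ∧ oi = y ∧ oo = overOp y x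

theorem CrossingColors.pos {ui uo oi oo x y : X} (h : CrossingColors 1 ui uo oi oo x y) :
    ui = x ∧ uo = underOp x y ∧ oi = overOp y x ∧ oo = y := by
  simpa [CrossingColors] using h

theorem CrossingColors.neg {ui uo oi oo x y : X} (h : CrossingColors (-1) ui uo oi oo x y) :
    ui = underOp x y ∧ uo = x ∧ oi = y ∧ oo = overOp y x := by
  simpa [CrossingColors, show (-1 : ℤˣ) ≠ 1 by decide] using h

theorem ColoredTraceDiagram.crossingColors (D : ColoredTraceDiagram X) (s : D.Site) :
    CrossingColors (D.sign s) (D.color (D.pass s .lower)) (D.color (D.next (D.pass s .lower)))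
      (D.color (D.pass s .upper)) (D.color (D.next (D.pass s .upper)))
      (D.underLabel s) (D.overLabel s) := by
  rcases Int.units_eq_one_or (D.sign s) with h | h
  · simp only [CrossingColors, underLabel, overLabel, if_pos h]
    exact ⟨trivial, D.color_under_pos s h, D.color_over_pos s h, trivial⟩
  · have h' : D.sign s ≠ 1 := by rw [h]; decide
    simp only [CrossingColors, underLabel, overLabel, if_neg h']
    exact ⟨D.color_under_neg s h, trivial, trivial, D.color_over_neg s h⟩

end Colors

/-! ### The bracket of a diagram with an inserted tangle -/

namespace Insertion

variable {X : Type*} [Biquandle X] {m : ℕ} {O : TraceDiagram} {port : Fin m ↪ O.Vertex}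
  {S P : Type} {sg : S → ℤˣ} {arc : Fin m → List (S × Strand ⊕ P)} {D : ColoredTraceDiagram X}
  (I : Insertion O port ⟨S, P, sg, arc⟩ D.toTraceDiagram)

/-- The labels of the crossings of an inserted tangle. -/
def label (s : S) : X × X :=
  (D.underLabel (I.site (Sum.inr s)), D.overLabel (I.site (Sum.inr s)))

/-- The color of the edge that arrives at a stop of an arc. -/
def stopColor (t : Fin m ⊕ (S × Strand ⊕ P)) : X :=
  D.color (Sum.elim (fun j => I.outside (O.next (port j))) I.inside t)

theorem crossingColors {c : Course m S P} (hc : c.Describes I) (s : S) :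
    CrossingColors (sg s) (I.stopColor (Sum.inr (Sum.inl (s, .lower))))
      (I.stopColor (c.succ (Sum.inl (s, .lower))))
      (I.stopColor (Sum.inr (Sum.inl (s, .upper))))
      (I.stopColor (c.succ (Sum.inl (s, .upper)))) (I.label s).1 (I.label s).2 := by
  have hp : ∀ a, D.pass (I.site (Sum.inr s)) a = I.inside (Sum.inl (s, a)) := fun a => by
    rw [I.inside_eq]; rfl
  have h := D.crossingColors (I.site (Sum.inr s))
  rw [I.sign_inside, hp, hp, hc.succ, hc.succ] at h
  exact h

variable {S' P' : Type}
  {sg' : S' → ℤˣ} {arc' : Fin m → List (S' × Strand ⊕ P')} {D' : ColoredTraceDiagram X}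
  {I' : Insertion O port ⟨S', P', sg', arc'⟩ D'.toTraceDiagram} {I}

theorem stopColor_exit (hcolor : ∀ v, D.color (I.outside v) = D'.color (I'.outside v)) (i : Fin m) :
    I.stopColor (Sum.inl i) = I'.stopColor (Sum.inl i) := hcolor _

theorem stopColor_first
    (hnext : ∀ v, D.color (D.next (I.outside v)) = D'.color (D'.next (I'.outside v)))
    {c : Course m S P} (hc : c.Describes I) {c' : Course m S' P'} (hc' : c'.Describes I')
    (i : Fin m) : I.stopColor (c.first i) = I'.stopColor (c'.first i) := by
  have h := hnext (port i)
  rw [hc.first, hc'.first] at h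
  exact h

end Insertion

namespace BiquandleBracket

variable {X : Type*} [Biquandle X] {R : Type*} [CommRing R] (β : BiquandleBracket X R)

/-- The skein coefficient of a smoothing of a crossing of sign `ε` with the labels `x`, `y`. -/
def crossingCoeff (ε : ℤˣ) (x y : X) : Smoothing → Rˣ
  | .A => β.A x y ^ (ε : ℤ)
  | .B => β.B x y ^ (ε : ℤ)

theorem coeff_eq_crossingCoeff (D : ColoredTraceDiagram X) (s : D.Site) (t : Smoothing) :
    β.coeff D s t = β.crossingCoeff (D.sign s) (D.underLabel s) (D.overLabel s) t := by
  cases t <;> rfl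

/-- The contribution of a tangle with the signs `sg` and the labels `l` to the bracket, if the edges
that enter or leave the disc are joined outside of it in a way that is recorded by `F`: the value
of `F` at a pattern is the value of the curves that pass through the boundary of the disc. -/
noncomputable def tangleSum {m : ℕ} {S P : Type} [Fintype S] [DecidableEq S] [FinEnum S] [FinEnum P]
    (sg : S → ℤˣ) (l : S → X × X) (c : Course m S P) (F : (Fin m ⊕ Fin m → ℕ) → R) : R :=
  ((β.w ^ (-∑ s, (sg s : ℤ)) : Rˣ) : R) * ∑ ρ : S → Smoothing,
    (∏ s, (β.crossingCoeff (sg s) (l s).1 (l s).2 (ρ s) : R)) *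
      (β.δ ^ c.loops ρ * F (c.pattern ρ))

section Insertion

variable {m : ℕ} {O : TraceDiagram} {port : Fin m ↪ O.Vertex} {S P : Type}
  {sg : S → ℤˣ} {arc : Fin m → List (S × Strand ⊕ P)} {D : ColoredTraceDiagram X}
  (I : Insertion O port ⟨S, P, sg, arc⟩ D.toTraceDiagram)

theorem writheFactor_insertion [Fintype S]
    (I : Insertion O port ⟨S, P, sg, arc⟩ D.toTraceDiagram) : β.writheFactor D =
    β.w ^ (-∑ s, (O.sign s : ℤ)) * β.w ^ (-∑ s, (sg s : ℤ)) := by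
  rw [writheFactor_eq, ← zpow_add, ← neg_add]
  congr 2
  rw [← Equiv.sum_comp I.site, Fintype.sum_sum_type]
  simp only [I.sign_outside, I.sign_inside]

variable {S' P' : Type}
  {sg' : S' → ℤˣ} {arc' : Fin m → List (S' × Strand ⊕ P')} {D' : ColoredTraceDiagram X}
  (I' : Insertion O port ⟨S', P', sg', arc'⟩ D'.toTraceDiagram)

theorem siteWeight_outside (hcolor : ∀ v, D.color (I.outside v) = D'.color (I'.outside v))
    (hnext : ∀ v, D.color (D.next (I.outside v)) = D'.color (D'.next (I'.outside v)))
    (s : O.Site) (t : Smoothing) :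
    β.siteWeight D (I.site (Sum.inl s)) t = β.siteWeight D' (I'.site (Sum.inl s)) t := by
  have hp : ∀ a, D.pass (I.site (Sum.inl s)) a = I.outside (Sum.inl (s, a)) := fun a => by
    rw [I.outside_eq]; rfl
  have hp' : ∀ a, D'.pass (I'.site (Sum.inl s)) a = I'.outside (Sum.inl (s, a)) := fun a => by
    rw [I'.outside_eq]; rfl
  have hcoeff : β.coeff D (I.site (Sum.inl s)) t = β.coeff D' (I'.site (Sum.inl s)) t := by
    rw [coeff_eq_crossingCoeff, coeff_eq_crossingCoeff]
    simp only [ColoredTraceDiagram.underLabel, ColoredTraceDiagram.overLabel, I.sign_outside,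
      I'.sign_outside, hp, hp', hcolor, hnext]
  cases hk : O.kind s with
  | crossing =>
    rw [β.siteWeight_crossing ((I.kind_outside s).trans hk),
      β.siteWeight_crossing ((I'.kind_outside s).trans hk), hcoeff]
  | trace t' =>
    rw [β.siteWeight_trace ((I.kind_outside s).trans hk),
      β.siteWeight_trace ((I'.kind_outside s).trans hk)]

variable [Fintype S] [DecidableEq S] [FinEnum S] [FinEnum P]
  [Fintype S'] [DecidableEq S'] [FinEnum S'] [FinEnum P']

theorem traceBracket_insertion {c : Course m S P} (hc : c.Describes I) :
    β.traceBracket D = ∑ τ : O.Site → Smoothing,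
      (((β.w ^ (-∑ s, (O.sign s : ℤ)) : Rˣ) : R) *
        ∏ s, β.siteWeight D (I.site (Sum.inl s)) (τ s)) *
      β.tangleSum sg I.label c fun k =>
        β.δ ^ Nat.card (Quot (BoundaryJoined (Insertion.boundary port τ) k)) := by
  let e : (O.Site → Smoothing) × (S → Smoothing) ≃ (D.Site → Smoothing) :=
    (Equiv.sumArrowEquivProdArrow _ _ _).symm.trans (Equiv.arrowCongr I.site (Equiv.refl _))
  have he : ∀ τ ρ, e (τ, ρ) = Sum.elim τ ρ ∘ I.site.symm := fun τ ρ => rfl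
  have hcomp : ∀ τ ρ, (D.smoothAll (e (τ, ρ))).componentCount = c.loops ρ +
      Nat.card (Quot (BoundaryJoined (Insertion.boundary port τ) (c.pattern ρ))) := by
    intro τ ρ
    rw [← c.card_quot_map_adj ρ (Insertion.boundary port τ), ← I.card_quot_smoothedAdj hc τ ρ]
    refine Nat.card_congr (Quot.congr (Equiv.refl _) fun a b => ?_)
    exact (D.smoothAll (e (τ, ρ))).toTraceDiagram.adjacent_iff_smoothedAdj (e (τ, ρ))
      (fun _ => rfl) a b
  have hprod : ∀ τ ρ, ∏ s, β.siteWeight D s (e (τ, ρ) s) =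
      (∏ s, β.siteWeight D (I.site (Sum.inl s)) (τ s)) *
        ∏ s, (β.crossingCoeff (sg s) (I.label s).1 (I.label s).2 (ρ s) : R) := by
    intro τ ρ
    rw [← Equiv.prod_comp I.site, Fintype.prod_sum_type]
    congr 1
    · exact Finset.prod_congr rfl fun s _ => by simp [he]
    · refine Finset.prod_congr rfl fun s _ => ?_
      rw [β.siteWeight_crossing (I.kind_inside s), coeff_eq_crossingCoeff, I.sign_inside]
      simp [he, Insertion.label]
  rw [traceBracket, β.writheFactor_insertion I, ← e.sum_comp, Fintype.sum_prod_type,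
    Finset.mul_sum]
  refine Finset.sum_congr rfl fun τ _ => ?_
  simp only [hcomp, hprod, tangleSum, Finset.mul_sum]
  refine Finset.sum_congr rfl fun ρ _ => ?_
  rw [pow_add]
  push_cast
  ring

/-- Diagrams that agree outside of a disc have equal brackets if the tangles inside of it
contribute equally for every behaviour of the outside. -/
theorem traceBracket_eq_of_tangleSum_eq
    (hcolor : ∀ v, D.color (I.outside v) = D'.color (I'.outside v))
    (hnext : ∀ v, D.color (D.next (I.outside v)) = D'.color (D'.next (I'.outside v)))
    {c : Course m S P} (hc : c.Describes I) {c' : Course m S' P'} (hc' : c'.Describes I')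
    (h : ∀ F, β.tangleSum sg I.label c F = β.tangleSum sg' I'.label c' F) :
    β.traceBracket D = β.traceBracket D' := by
  rw [β.traceBracket_insertion I hc, β.traceBracket_insertion I' hc']
  refine Finset.sum_congr rfl fun τ _ => ?_
  simp only [h, β.siteWeight_outside I I' hcolor hnext]

end Insertion

end BiquandleBracket

/-! ### Triangles -/

section Colors
variable {X : Type*} [Biquandle X]

/-- The labels of the three crossings, all positive, on the side of a move of type III where the
bottom arc meets the middle arc first. The bottom arc enters with the color `x`, the middle arc has
the color `y` between its two crossings, and the top arc exits with the color `z`. -/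
def nearLabel (x y z : X) : Fin 3 → X × X :=
  ![(y, z), (underOp x y, overOp z y), (x, y)]

/-- The labels of the crossings of a triangle, on the side opposite to that of `nearLabel`. Each
crossing has the same index as its counterpart there. -/
def farLabel (x y z : X) : Fin 3 → X × X :=
  ![(overOp y x, overOp z x), (x, z), (underOp x z, underOp y z)]

end Colors

/-- The course through a triangle. The arcs pass their two crossings in the orders of
`DiscTangle.triangle` if the entries of `o` are `1`, and in the opposite orders otherwise. -/
def Course.triangle (o : Fin 3 → ℤˣ) : Course 3 (Fin 3) Empty where
  first i := match i with
    | 0 => if o 0 = 1 then Sum.inr (Sum.inl (0, .upper)) else Sum.inr (Sum.inl (1, .upper))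
    | 1 => if o 1 = 1 then Sum.inr (Sum.inl (0, .lower)) else Sum.inr (Sum.inl (2, .upper))
    | 2 => if o 2 = 1 then Sum.inr (Sum.inl (1, .lower)) else Sum.inr (Sum.inl (2, .lower))
  succ n := match n with
    | Sum.inl (0, .upper) => if o 0 = 1 then Sum.inr (Sum.inl (1, .upper)) else Sum.inl 0
    | Sum.inl (1, .upper) => if o 0 = 1 then Sum.inl 0 else Sum.inr (Sum.inl (0, .upper))
    | Sum.inl (0, .lower) => if o 1 = 1 then Sum.inr (Sum.inl (2, .upper)) else Sum.inl 1
    | Sum.inl (2, .upper) => if o 1 = 1 then Sum.inl 1 else Sum.inr (Sum.inl (0, .lower))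
    | Sum.inl (1, .lower) => if o 2 = 1 then Sum.inr (Sum.inl (2, .lower)) else Sum.inl 2
    | Sum.inl (2, .lower) => if o 2 = 1 then Sum.inl 2 else Sum.inr (Sum.inl (1, .lower))

/-- The orders in which the arcs of a triangle pass their crossings. -/
def triangleOrder (ε : Fin 3 → ℤˣ) (τ : ℤˣ) : Fin 3 → ℤˣ :=
  ![τ, τ * ε 1 * ε 2, τ * ε 0 * ε 2]

/-- The labels of the crossings on the two sides `l`, `l'` of a move of type III. If all crossings are
positive, then the labels on the two sides are `farLabel` and `nearLabel`. For other signs, moving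
a crossing across the move as an inverse exchanges its two labels. -/
theorem triangle_labels {X : Type*} [Biquandle X] (ε : Fin 3 → ℤˣ)
    (κ κ' : Fin 3 ⊕ (Fin 3 × Strand ⊕ Empty) → X) (l l' : Fin 3 → X × X)
    (hexit : ∀ i, κ (Sum.inl i) = κ' (Sum.inl i))
    (hfirst : ∀ i, κ ((Course.triangle (triangleOrder ε 1)).first i) =
      κ' ((Course.triangle (triangleOrder ε (-1))).first i))
    (h : ∀ s, CrossingColors (ε s)
      (κ (Sum.inr (Sum.inl (s, .lower))))
      (κ ((Course.triangle (triangleOrder ε 1)).succ (Sum.inl (s, .lower))))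
      (κ (Sum.inr (Sum.inl (s, .upper))))
      (κ ((Course.triangle (triangleOrder ε 1)).succ (Sum.inl (s, .upper)))) (l s).1 (l s).2)
    (h' : ∀ s, CrossingColors (ε s)
      (κ' (Sum.inr (Sum.inl (s, .lower))))
      (κ' ((Course.triangle (triangleOrder ε (-1))).succ (Sum.inl (s, .lower))))
      (κ' (Sum.inr (Sum.inl (s, .upper))))
      (κ' ((Course.triangle (triangleOrder ε (-1))).succ (Sum.inl (s, .upper))))
      (l' s).1 (l' s).2) :
    ∃ x y z, ∀ i, (l i, l' i) = if ε i = -(ε 0 * ε 1) then (nearLabel x y z i, farLabel x y z i)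
      else (farLabel x y z i, nearLabel x y z i) := by
  refine ⟨if ε 2 = -(ε 0 * ε 1) then (l 2).1 else (l' 2).1,
    if ε 0 = -(ε 0 * ε 1) then (l 0).1 else (l' 0).1,
    if ε 0 = -(ε 0 * ε 1) then (l 0).2 else (l' 0).2, ?_⟩
  -- On both sides the colors of the boundary agree, so for each of the eight sign patterns the labels
  -- can be computed from one end of the arcs to the other.
  simp only [Fin.forall_fin_succ, Course.triangle, triangleOrder, CrossingColors] at *
  obtain ⟨e₀, he₀⟩ : ∃ e, ε 0 = e := ⟨_, rfl⟩
  obtain ⟨e₁, he₁⟩ : ∃ e, ε 1 = e := ⟨_, rfl⟩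
  obtain ⟨e₂, he₂⟩ : ∃ e, ε 2 = e := ⟨_, rfl⟩
  have hne : (-1 : ℤˣ) ≠ 1 := by decide
  have hne' : (1 : ℤˣ) ≠ -1 := by decide
  rcases Int.units_eq_one_or e₀ with rfl | rfl <;> rcases Int.units_eq_one_or e₁ with rfl | rfl <;>
    rcases Int.units_eq_one_or e₂ with rfl | rfl <;>
    simp [he₀, he₁, he₂, hne, hne', nearLabel, farLabel, Prod.ext_iff] at * <;>
    grind [Biquandle.under_injective, Biquandle.over_injective, Biquandle.sideways_injective,
      Biquandle.exchange_under_under, Biquandle.exchange_under_over, Biquandle.exchange_over_over]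

/-! ### Local identities -/

section States

variable {R : Type*} [CommRing R]

theorem sum_smoothing (f : Smoothing → R) : ∑ t, f t = f .A + f .B :=
  Finset.sum_pair (by decide)

theorem sum_smoothing_unit (f : (Unit → Smoothing) → R) :
    ∑ ρ, f ρ = f (fun _ => .A) + f fun _ => .B := by
  rw [← (Equiv.funUnique Unit Smoothing).symm.sum_comp, sum_smoothing]
  rfl

theorem sum_smoothing_fin_two (f : (Fin 2 → Smoothing) → R) :
    ∑ ρ, f ρ = f ![.A, .A] + f ![.A, .B] + (f ![.B, .A] + f ![.B, .B]) := by
  rw [← (finTwoArrowEquiv Smoothing).symm.sum_comp, Fintype.sum_prod_type, sum_smoothing,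
    sum_smoothing, sum_smoothing]
  rfl

theorem sum_smoothing_fin_three (f : (Fin 3 → Smoothing) → R) :
    ∑ ρ, f ρ = f ![.A, .A, .A] + f ![.A, .A, .B] + (f ![.A, .B, .A] + f ![.A, .B, .B]) +
      (f ![.B, .A, .A] + f ![.B, .A, .B] + (f ![.B, .B, .A] + f ![.B, .B, .B])) := by
  rw [← (Fin.consEquiv fun _ : Fin 3 => Smoothing).sum_comp, Fintype.sum_prod_type, sum_smoothing,
    sum_smoothing_fin_two, sum_smoothing_fin_two]
  rfl

/-- The weights of the smoothings of a crossing, divided by the coefficient of the smoothing of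
type `A`. -/
def ratioWeight (u : R) : Smoothing → R
  | .A => 1
  | .B => u

/-- The patterns of the smoothings on the two sides `c`, `d` of a move of type III with three
strands that can be directed to the same side. The sites are numbered by `π`, so that site `1` is
the middle one: it is the crossing of the first and the last of the strands in a half-plane
containing their directions. The smoothing of only this crossing on one side has the same pattern
as four smoothings on the other side, one of which contains a closed curve. -/
abbrev BraidPatterns (c d : Course 3 (Fin 3) Empty) (π : Equiv.Perm (Fin 3)) : Prop :=
  (∀ ρ ∈ [![Smoothing.A, .A, .B], ![.B, .A, .A], ![.B, .A, .B], ![.B, .B, .B]],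
    c.pattern (ρ ∘ π) = d.pattern (![.A, .B, .A] ∘ π) ∧
    d.pattern (ρ ∘ π) = c.pattern (![.A, .B, .A] ∘ π)) ∧
  (∀ ρ ∈ [![Smoothing.A, .A, .A], ![.A, .B, .B], ![.B, .B, .A]],
    c.pattern (ρ ∘ π) = d.pattern (ρ ∘ π)) ∧
  ∀ ρ : Fin 3 → Smoothing, c.loops (ρ ∘ π) = (if ρ = ![.B, .A, .B] then 1 else 0) ∧
    d.loops (ρ ∘ π) = if ρ = ![.B, .A, .B] then 1 else 0

theorem BraidPatterns.sum_eq {c d : Course 3 (Fin 3) Empty} {π : Equiv.Perm (Fin 3)}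
    (hcd : BraidPatterns c d π) {δ : R} {u v : Fin 3 → Rˣ}
    (h : BraidRelation δ (u (π.symm 0)) (u (π.symm 1)) (u (π.symm 2))
      (v (π.symm 0)) (v (π.symm 1)) (v (π.symm 2)))
    (F : (Fin 3 ⊕ Fin 3 → ℕ) → R) :
    ∑ ρ : Fin 3 → Smoothing, (∏ s, ratioWeight (u s : R) (ρ s)) *
        (δ ^ c.loops ρ * F (c.pattern ρ)) =
      ∑ ρ : Fin 3 → Smoothing, (∏ s, ratioWeight (v s : R) (ρ s)) *
        (δ ^ d.loops ρ * F (d.pattern ρ)) := by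
  have reindex : ∀ (e : Course 3 (Fin 3) Empty) (u : Fin 3 → Rˣ),
      ∑ ρ : Fin 3 → Smoothing, (∏ s, ratioWeight (u s : R) (ρ s)) *
        (δ ^ e.loops ρ * F (e.pattern ρ)) =
      ∑ ρ : Fin 3 → Smoothing, (∏ s, ratioWeight (u (π.symm s) : R) (ρ s)) *
        (δ ^ e.loops (ρ ∘ π) * F (e.pattern (ρ ∘ π))) := by
    intro e u
    rw [← (Equiv.arrowCongr π.symm (Equiv.refl Smoothing)).sum_comp]
    refine Finset.sum_congr rfl fun ρ _ => ?_
    have hρ : Equiv.arrowCongr π.symm (Equiv.refl Smoothing) ρ = ρ ∘ π := rfl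
    rw [hρ, ← π.symm.prod_comp]
    simp
  have hfirst := congrArg Units.val h.first
  have hlast := congrArg Units.val h.last
  push_cast at hfirst hlast
  rw [reindex, reindex]
  obtain ⟨hcross, heq, hloops⟩ := hcd
  simp only [List.forall_mem_cons, List.not_mem_nil, false_imp_iff, implies_true, and_true]
    at hcross heq
  simp only [sum_smoothing_fin_three, hloops, hcross, heq, Fin.prod_univ_three]
  simp [ratioWeight]
  linear_combination F (d.pattern (![.A, .B, .A] ∘ π)) * h.left +
    F (c.pattern (![.A, .B, .A] ∘ π)) * h.right +
    F (d.pattern (![.B, .B, .A] ∘ π)) * hfirst + F (d.pattern (![.A, .B, .B] ∘ π)) * hlast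

/-- The patterns of the smoothings on the two sides `c`, `d` of a move of type III with a
cyclically oriented triangle. Here the smoothing of type `B` of all crossings on one side has the
same pattern as four smoothings on the other side, one of which contains a closed curve. -/
abbrev CyclicPatterns (c d : Course 3 (Fin 3) Empty) : Prop :=
  (∀ ρ ∈ [![Smoothing.A, .A, .A], ![.A, .A, .B], ![.A, .B, .A], ![.B, .A, .A]],
    c.pattern ρ = d.pattern ![.B, .B, .B] ∧ d.pattern ρ = c.pattern ![.B, .B, .B]) ∧
  (∀ ρ ∈ [![Smoothing.B, .B, .A], ![.B, .A, .B], ![.A, .B, .B]], c.pattern ρ = d.pattern ρ) ∧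
  ∀ ρ : Fin 3 → Smoothing, c.loops ρ = (if ρ = ![.A, .A, .A] then 1 else 0) ∧
    d.loops ρ = if ρ = ![.A, .A, .A] then 1 else 0

theorem CyclicPatterns.sum_eq {c d : Course 3 (Fin 3) Empty}
    (hcd : CyclicPatterns c d) {δ : R} {u v : Fin 3 → Rˣ}
    (h : CyclicRelation δ (u 0) (u 1) (u 2) (v 0) (v 1) (v 2))
    (F : (Fin 3 ⊕ Fin 3 → ℕ) → R) :
    ∑ ρ : Fin 3 → Smoothing, (∏ s, ratioWeight (u s : R) (ρ s)) *
        (δ ^ c.loops ρ * F (c.pattern ρ)) =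
      ∑ ρ : Fin 3 → Smoothing, (∏ s, ratioWeight (v s : R) (ρ s)) *
        (δ ^ d.loops ρ * F (d.pattern ρ)) := by
  have hfirst := congrArg Units.val h.first
  have hlast := congrArg Units.val h.last
  have houter := congrArg Units.val h.outer
  push_cast at hfirst hlast houter
  obtain ⟨hcross, heq, hloops⟩ := hcd
  simp only [List.forall_mem_cons, List.not_mem_nil, false_imp_iff, implies_true, and_true]
    at hcross heq
  simp only [sum_smoothing_fin_three, hloops, hcross, heq, Fin.prod_univ_three]
  simp [ratioWeight]
  linear_combination F (d.pattern ![.B, .B, .B]) * h.left +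
    F (c.pattern ![.B, .B, .B]) * h.right +
    F (d.pattern ![.B, .B, .A]) * hfirst + F (d.pattern ![.A, .B, .B]) * hlast +
    F (d.pattern ![.B, .A, .B]) * houter

end States

section Triangle
variable {R : Type*} [CommRing R]

/-- The local identity of the moves of type III. Here `t` and `s` are the ratios for positive
crossings with the near and with the far labels, and `u` and `v` are the actual ratios on the two
sides. -/
theorem sum_ratioWeight_triangle (ε : Fin 3 → ℤˣ) {δ : R} {t s u v : Fin 3 → Rˣ}
    (h : BraidRelation δ (t 0) (t 1) (t 2) (s 0) (s 1) (s 2))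
    (huv : ∀ i, (u i, v i) = if ε i = -(ε 0 * ε 1) then (t i ^ (ε i : ℤ), s i ^ (ε i : ℤ))
      else (s i ^ (ε i : ℤ), t i ^ (ε i : ℤ)))
    (F : (Fin 3 ⊕ Fin 3 → ℕ) → R) :
    ∑ ρ : Fin 3 → Smoothing, (∏ s, ratioWeight (u s : R) (ρ s)) *
        (δ ^ (Course.triangle (triangleOrder ε 1)).loops ρ *
          F ((Course.triangle (triangleOrder ε 1)).pattern ρ)) =
      ∑ ρ : Fin 3 → Smoothing, (∏ s, ratioWeight (v s : R) (ρ s)) *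
        (δ ^ (Course.triangle (triangleOrder ε (-1))).loops ρ *
          F ((Course.triangle (triangleOrder ε (-1))).pattern ρ)) := by
  obtain ⟨e₀, he₀⟩ : ∃ e, ε 0 = e := ⟨_, rfl⟩
  obtain ⟨e₁, he₁⟩ : ∃ e, ε 1 = e := ⟨_, rfl⟩
  obtain ⟨e₂, he₂⟩ : ∃ e, ε 2 = e := ⟨_, rfl⟩
  have hne : (-1 : ℤˣ) ≠ 1 := by decide
  have hne' : (1 : ℤˣ) ≠ -1 := by decide
  simp only [triangleOrder]
  have h₀ := huv 0
  have h₁ := huv 1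
  have h₂ := huv 2
  rcases Int.units_eq_one_or e₀ with rfl | rfl <;> rcases Int.units_eq_one_or e₁ with rfl | rfl <;>
    rcases Int.units_eq_one_or e₂ with rfl | rfl <;>
    simp [he₀, he₁, he₂, hne, hne', Prod.ext_iff] at h₀ h₁ h₂ ⊢
  · refine BraidPatterns.sum_eq (π := 1) (by decide +kernel) ?_ F
    change BraidRelation δ (u 0) (u 1) (u 2) (v 0) (v 1) (v 2)
    simpa only [h₀, h₁, h₂] using h.symm
  · refine BraidPatterns.sum_eq (π := Equiv.swap 0 1) (by decide +kernel) ?_ F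
    change BraidRelation δ (u 1) (u 0) (u 2) (v 1) (v 0) (v 2)
    simpa only [h₀, h₁, h₂] using h.rotate.symm.reverse
  · refine CyclicPatterns.sum_eq (by decide +kernel) ?_ F
    simpa only [h₀, h₁, h₂] using h.cyclic
  · refine BraidPatterns.sum_eq (π := Equiv.swap 1 2) (by decide +kernel) ?_ F
    change BraidRelation δ (u 0) (u 2) (u 1) (v 0) (v 2) (v 1)
    simpa only [h₀, h₁, h₂] using h.rotate.rotate.reverse
  · refine BraidPatterns.sum_eq (π := Equiv.swap 1 2) (by decide +kernel) ?_ F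
    change BraidRelation δ (u 0) (u 2) (u 1) (v 0) (v 2) (v 1)
    simpa only [h₀, h₁, h₂] using h.reverse.rotate
  · refine CyclicPatterns.sum_eq (by decide +kernel) ?_ F
    simpa only [h₀, h₁, h₂, inv_inv] using h.rotate.rotate.rotate.cyclic
  · refine BraidPatterns.sum_eq (π := Equiv.swap 0 1) (by decide +kernel) ?_ F
    change BraidRelation δ (u 1) (u 0) (u 2) (v 1) (v 0) (v 2)
    simpa only [h₀, h₁, h₂] using h.reverse.rotate.rotate.symm
  · refine BraidPatterns.sum_eq (π := 1) (by decide +kernel) ?_ F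
    change BraidRelation δ (u 0) (u 1) (u 2) (v 0) (v 1) (v 2)
    simpa only [h₀, h₁, h₂] using h.rotate.rotate.rotate.symm

end Triangle

/-! ### Courses of the tangles in the moves -/

namespace Course

/-- The course through arcs without vertices. -/
def bare (m : ℕ) : Course m Empty Empty where
  first := Sum.inl
  succ := Sum.elim (fun p => p.1.elim) Empty.elim

/-- The course through a marked point. -/
def marked : Course 1 Empty Unit where
  first _ := Sum.inr (Sum.inr ())
  succ _ := Sum.inl 0

/-- The course through a kink that passes its crossing first along `a` and then along `b`. -/
def kink (a b : Strand) : Course 1 Unit Empty where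
  first _ := Sum.inr (Sum.inl ((), a))
  succ n := if n = Sum.inl ((), a) then Sum.inr (Sum.inl ((), b)) else Sum.inl 0

/-- The course through a bigon with parallel (`τ = 1`) or antiparallel (`τ = -1`) arcs. -/
def bigon (τ : ℤˣ) : Course 2 (Fin 2) Empty where
  first i := match i with
    | 0 => Sum.inr (Sum.inl (0, .upper))
    | 1 => if τ = 1 then Sum.inr (Sum.inl (0, .lower)) else Sum.inr (Sum.inl (1, .lower))
  succ n := match n with
    | Sum.inl (0, .upper) => Sum.inr (Sum.inl (1, .upper))
    | Sum.inl (1, .upper) => Sum.inl 0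
    | Sum.inl (0, .lower) => if τ = 1 then Sum.inr (Sum.inl (1, .lower)) else Sum.inl 1
    | Sum.inl (1, .lower) => if τ = 1 then Sum.inl 1 else Sum.inr (Sum.inl (0, .lower))

variable {O : TraceDiagram} {D : TraceDiagram}

theorem next_of_route_ordered {m : ℕ} {α : Type} {f : α → D.Vertex} {g : Fin m → D.Vertex}
    {o : ℤˣ} {a b : α} {v : D.Vertex} {i : Fin m}
    (h : D.Route v ((DiscTangle.ordered o a b).map f) (g i)) :
    D.next v = Sum.elim g f (if o = 1 then Sum.inr a else Sum.inr b) ∧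
      D.next (f a) = Sum.elim g f (if o = 1 then Sum.inr b else Sum.inl i) ∧
      D.next (f b) = Sum.elim g f (if o = 1 then Sum.inl i else Sum.inr a) := by
  unfold DiscTangle.ordered at h
  split_ifs at h ⊢
  · exact h
  · exact ⟨h.1, h.2.2, h.2.1⟩

theorem describes_bare {m : ℕ} {port : Fin m ↪ O.Vertex}
    (I : Insertion O port (DiscTangle.bare m) D) : (bare m).Describes I where
  first i := I.route i
  succ n := by rcases n with ⟨⟨⟩, _⟩ | ⟨⟨⟩⟩

theorem describes_marked {port : Fin 1 ↪ O.Vertex}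
    (I : Insertion O port DiscTangle.marked D) : marked.Describes I where
  first i := by
    obtain rfl := Subsingleton.elim i 0
    exact (I.route 0).1
  succ n := by
    rcases n with ⟨⟨⟩, _⟩ | ⟨⟨⟩⟩
    exact (I.route 0).2

theorem describes_kink {port : Fin 1 ↪ O.Vertex} {ε : ℤˣ} {a b : Strand} (hab : a ≠ b)
    (I : Insertion O port (DiscTangle.kink ε a b) D) : (kink a b).Describes I where
  first i := by
    obtain rfl := Subsingleton.elim i 0
    exact (I.route 0).1
  succ n := by
    have h₁ : D.next (I.inside (Sum.inl ((), a))) = I.inside (Sum.inl ((), b)) := (I.route 0).2.1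
    have h₂ : D.next (I.inside (Sum.inl ((), b))) = I.outside (O.next (port 0)) := (I.route 0).2.2
    rcases n with ⟨⟨⟩, x⟩ | ⟨⟨⟩⟩
    have hx : x = a ∨ x = b := by cases x <;> cases a <;> cases b <;> simp_all
    rcases hx with rfl | rfl
    · exact h₁.trans (by simp [kink]; rfl)
    · exact h₂.trans (by simp [kink, hab.symm])

theorem describes_bigon {port : Fin 2 ↪ O.Vertex} {ε τ : ℤˣ}
    (I : Insertion O port (DiscTangle.bigon ε τ) D) : (bigon τ).Describes I := by
  obtain ⟨h₀, h₀', h₀''⟩ := I.route 0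
  obtain ⟨h₁, h₁', h₁''⟩ := next_of_route_ordered (α := Fin 2 × Strand ⊕ Empty) (f := I.inside)
    (g := fun j => I.outside (O.next (port j)))
    (o := τ) (a := Sum.inl (0, .lower)) (b := Sum.inl (1, .lower)) (I.route 1)
  constructor
  · intro i
    fin_cases i
    · exact h₀
    · exact h₁
  · rintro (⟨s, a⟩ | ⟨⟨⟩⟩)
    fin_cases s <;> cases a
    · exact h₀'
    · exact h₁'
    · exact h₀''
    · exact h₁''

theorem describes_triangle {port : Fin 3 ↪ O.Vertex} {ε : Fin 3 → ℤˣ} {τ : ℤˣ}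
    (I : Insertion O port (DiscTangle.triangle ε τ) D) :
    (triangle (triangleOrder ε τ)).Describes I := by
  obtain ⟨h₀, h₀', h₀''⟩ := next_of_route_ordered (α := Fin 3 × Strand ⊕ Empty) (f := I.inside)
    (g := fun j => I.outside (O.next (port j)))
    (o := τ) (a := Sum.inl (0, .upper)) (b := Sum.inl (1, .upper)) (I.route 0)
  obtain ⟨h₁, h₁', h₁''⟩ := next_of_route_ordered (α := Fin 3 × Strand ⊕ Empty) (f := I.inside)
    (g := fun j => I.outside (O.next (port j)))
    (o := τ * ε 1 * ε 2) (a := Sum.inl (0, .lower)) (b := Sum.inl (2, .upper)) (I.route 1)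
  obtain ⟨h₂, h₂', h₂''⟩ := next_of_route_ordered (α := Fin 3 × Strand ⊕ Empty) (f := I.inside)
    (g := fun j => I.outside (O.next (port j)))
    (o := τ * ε 0 * ε 2) (a := Sum.inl (1, .lower)) (b := Sum.inl (2, .lower)) (I.route 2)
  constructor
  · intro i
    fin_cases i
    · exact h₀
    · exact h₁
    · exact h₂
  · rintro (⟨s, a⟩ | ⟨⟨⟩⟩)
    fin_cases s <;> cases a
    · exact h₀'
    · exact h₁'
    · exact h₀''
    · exact h₂'
    · exact h₁''
    · exact h₂''

end Course

/-! ### Invariance of the contributions of the tangles -/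

namespace BiquandleBracket

variable {X : Type*} [Biquandle X] {R : Type*} [CommRing R] (β : BiquandleBracket X R)

/-- The ratio of the coefficients at a positive crossing with the labels `p`. -/
def ratio (p : X × X) : Rˣ := (β.A p.1 p.2)⁻¹ * β.B p.1 p.2

theorem isLoopValue_ratio (p : X × X) : IsLoopValue β.δ (β.ratio p) := by
  have h := β.δ_eq p.1 p.2
  unfold IsLoopValue
  rw [← h, ratio, mul_inv, inv_inv]
  ring

theorem B_eq (x y : X) : β.B x y = β.A x y * β.ratio (x, y) := by simp [ratio]

theorem crossingCoeff_eq (ε : ℤˣ) (x y : X) (t : Smoothing) : (β.crossingCoeff ε x y t : R) =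
    ((β.A x y ^ (ε : ℤ) : Rˣ) : R) * ratioWeight ((β.ratio (x, y) ^ (ε : ℤ) : Rˣ) : R) t := by
  cases t
  · simp [crossingCoeff, ratioWeight]
  · rw [crossingCoeff, B_eq, mul_zpow, Units.val_mul]
    rfl

theorem isLoopValue_ratio_zpow (ε : ℤˣ) (p : X × X) :
    IsLoopValue β.δ (β.ratio p ^ (ε : ℤ)) := by
  rcases Int.units_eq_one_or ε with rfl | rfl
  · simpa using β.isLoopValue_ratio p
  · simpa using (β.isLoopValue_ratio p).inv

theorem prod_A_label (x y z : X) :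
    ∏ i, β.A (nearLabel x y z i).1 (nearLabel x y z i).2 =
      ∏ i, β.A (farLabel x y z i).1 (farLabel x y z i).2 := by
  have h := β.eq₁ x y z
  simp only [Fin.prod_univ_three, nearLabel, farLabel, Matrix.cons_val]
  rw [mul_comm, ← mul_assoc, h, mul_comm (β.A x z)]

theorem braidRelation_ratio (x y z : X) : BraidRelation β.δ
    (β.ratio (nearLabel x y z 0)) (β.ratio (nearLabel x y z 1)) (β.ratio (nearLabel x y z 2))
    (β.ratio (farLabel x y z 0)) (β.ratio (farLabel x y z 1)) (β.ratio (farLabel x y z 2)) := by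
  have h₁ := congrArg Units.val (β.eq₁ x y z)
  have h₂ := congrArg Units.val (β.eq₂ x y z)
  have h₃ := congrArg Units.val (β.eq₃ x y z)
  have h₄ := β.eq₄ x y z
  have h₅ := β.eq₅ x y z
  simp only [B_eq, Units.val_mul] at h₁ h₂ h₃ h₄ h₅
  have cancel : ∀ {a b : R}, ((β.A x y * β.A y z * β.A (underOp x y) (overOp z y) : Rˣ) : R) * a =
      ((β.A x y * β.A y z * β.A (underOp x y) (overOp z y) : Rˣ) : R) * b → a = b :=
    fun h => (Units.isUnit _).mul_left_cancel h
  simp only [Units.val_mul] at cancel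
  refine ⟨cancel ?_, cancel ?_, Units.ext (cancel ?_), Units.ext (cancel ?_),
    β.isLoopValue_ratio _, β.isLoopValue_ratio _, β.isLoopValue_ratio _,
    β.isLoopValue_ratio _, β.isLoopValue_ratio _, β.isLoopValue_ratio _⟩ <;>
    simp only [nearLabel, farLabel, Matrix.cons_val, Units.val_mul]
  · linear_combination h₅ - (β.ratio (x, z) : R) * h₁
  · linear_combination h₄ - (β.ratio (overOp y x, overOp z x) +
      β.ratio (underOp x z, underOp y z) + β.δ * β.ratio (overOp y x, overOp z x) *
      β.ratio (underOp x z, underOp y z) + β.ratio (overOp y x, overOp z x) * β.ratio (x, z) *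
      β.ratio (underOp x z, underOp y z) : R) * h₁
  · linear_combination h₂ - (β.ratio (x, z) * β.ratio (overOp y x, overOp z x) : R) * h₁
  · linear_combination h₃ - (β.ratio (x, z) * β.ratio (underOp x z, underOp y z) : R) * h₁

theorem tangleSum_eq {m : ℕ} {S P : Type} [Fintype S] [DecidableEq S] [FinEnum S] [FinEnum P]
    (sg : S → ℤˣ) (l : S → X × X) (c : Course m S P) (F : (Fin m ⊕ Fin m → ℕ) → R) :
    β.tangleSum sg l c F = ((β.w ^ (-∑ s, (sg s : ℤ)) : Rˣ) : R) *
      ((∏ s, β.A (l s).1 (l s).2 ^ (sg s : ℤ) : Rˣ) : R) * ∑ ρ : S → Smoothing,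
        (∏ s, ratioWeight ((β.ratio (l s) ^ (sg s : ℤ) : Rˣ) : R) (ρ s)) *
          (β.δ ^ c.loops ρ * F (c.pattern ρ)) := by
  simp only [tangleSum, crossingCoeff_eq, Finset.prod_mul_distrib, mul_assoc, Finset.mul_sum,
    Units.coe_prod]

theorem tangleSum_triangle (ε : Fin 3 → ℤˣ) {l l' : Fin 3 → X × X} {x y z : X}
    (hl : ∀ i, (l i, l' i) = if ε i = -(ε 0 * ε 1) then (nearLabel x y z i, farLabel x y z i)
      else (farLabel x y z i, nearLabel x y z i)) (F : (Fin 3 ⊕ Fin 3 → ℕ) → R) :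
    β.tangleSum ε l (Course.triangle (triangleOrder ε 1)) F =
      β.tangleSum ε l' (Course.triangle (triangleOrder ε (-1))) F := by
  have hA : ∏ s, β.A (l s).1 (l s).2 ^ (ε s : ℤ) = ∏ s, β.A (l' s).1 (l' s).2 ^ (ε s : ℤ) := by
    -- Each quotient of factors is the same power of the quotient of the near and the far one.
    have h : ∀ i, β.A (l i).1 (l i).2 ^ (ε i : ℤ) / β.A (l' i).1 (l' i).2 ^ (ε i : ℤ) =
        (β.A (nearLabel x y z i).1 (nearLabel x y z i).2 /
          β.A (farLabel x y z i).1 (farLabel x y z i).2) ^ ((-(ε 0 * ε 1) : ℤˣ) : ℤ) := by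
      intro i
      have hi := hl i
      split_ifs at hi with hε
      · obtain ⟨h₁, h₂⟩ := Prod.mk.inj hi
        rw [h₁, h₂, hε, div_zpow]
      · obtain ⟨h₁, h₂⟩ := Prod.mk.inj hi
        have hε' : ε i = - -(ε 0 * ε 1) := Int.units_ne_iff_eq_neg.1 hε
        rw [h₁, h₂, hε', Units.val_neg, ← div_zpow, ← inv_div, inv_zpow', neg_neg]
    rw [← div_eq_one, ← Finset.prod_div_distrib]
    simp only [h, Finset.prod_zpow, Finset.prod_div_distrib, β.prod_A_label, div_self', one_zpow]
  have huv : ∀ i, (β.ratio (l i) ^ (ε i : ℤ), β.ratio (l' i) ^ (ε i : ℤ)) =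
      if ε i = -(ε 0 * ε 1) then
        (β.ratio (nearLabel x y z i) ^ (ε i : ℤ), β.ratio (farLabel x y z i) ^ (ε i : ℤ))
      else (β.ratio (farLabel x y z i) ^ (ε i : ℤ), β.ratio (nearLabel x y z i) ^ (ε i : ℤ)) := by
    intro i
    have hi := hl i
    split_ifs at hi ⊢ <;> rw [(Prod.mk.inj hi).1, (Prod.mk.inj hi).2]
  have key := sum_ratioWeight_triangle ε (t := fun i => β.ratio (nearLabel x y z i))
    (s := fun i => β.ratio (farLabel x y z i)) (u := fun i => β.ratio (l i) ^ (ε i : ℤ))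
    (v := fun i => β.ratio (l' i) ^ (ε i : ℤ)) (β.braidRelation_ratio x y z) huv F
  rw [tangleSum_eq, tangleSum_eq, hA, key]

theorem tangleSum_of_isEmpty {m : ℕ} {S P : Type} [Fintype S] [DecidableEq S] [FinEnum S]
    [FinEnum P] [IsEmpty S] (sg : S → ℤˣ) (l : S → X × X) (c : Course m S P)
    (F : (Fin m ⊕ Fin m → ℕ) → R) :
    β.tangleSum sg l c F = β.δ ^ c.loops isEmptyElim * F (c.pattern isEmptyElim) := by
  simp only [tangleSum, Finset.univ_eq_empty, Finset.sum_empty, neg_zero, zpow_zero, Units.val_one,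
    one_mul, Finset.prod_empty, Fintype.sum_unique]
  congr

theorem tangleSum_kink (ε : ℤˣ) {a b : Strand} (hab : a ≠ b) (x : X)
    (F : (Fin 1 ⊕ Fin 1 → ℕ) → R) :
    β.tangleSum (fun _ => ε) (fun _ => (x, x)) (Course.kink a b) F =
      F ((Course.bare 1).pattern isEmptyElim) := by
  have hp : ∀ a b : Strand, a ≠ b → ∀ ρ, (Course.kink a b).pattern ρ =
      (Course.bare 1).pattern isEmptyElim := by decide +kernel
  have hl : ∀ a b : Strand, a ≠ b → ∀ ρ, (Course.kink a b).loops ρ =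
      if ρ () = .A then 1 else 0 := by decide +kernel
  have hw : β.w = -(β.A x x * (β.ratio (x, x))⁻¹) := by
    rw [← β.w_eq x, ratio, mul_inv, inv_inv, pow_two, mul_assoc]
  have hδ := (β.isLoopValue_ratio_zpow ε (x, x)).eq
  have hwε : β.w ^ (ε : ℤ) = -(β.A x x ^ (ε : ℤ) * (β.ratio (x, x) ^ (ε : ℤ))⁻¹) := by
    rw [hw]
    rcases Int.units_eq_one_or ε with rfl | rfl
    · simp
    · simp [mul_comm]
  simp only [tangleSum_eq, sum_smoothing_unit, hp a b hab, hl a b hab, Fintype.univ_punit,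
    Finset.prod_singleton, Finset.sum_singleton, ratioWeight, zpow_neg]
  generalize β.w ^ (ε : ℤ) = w at hwε ⊢
  generalize β.A x x ^ (ε : ℤ) = a at hwε ⊢
  generalize β.ratio (x, x) ^ (ε : ℤ) = r at hwε hδ ⊢
  have hw' := w.inv_mul
  replace hwε := congrArg Units.val hwε
  push_cast at hwε
  simp only [if_true, reduceCtorEq, if_false]
  linear_combination (((w⁻¹ : Rˣ) : R) * a * F ((Course.bare 1).pattern isEmptyElim)) * hδ -
    ((w⁻¹ : Rˣ) : R) * F ((Course.bare 1).pattern isEmptyElim) * hwε +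
    F ((Course.bare 1).pattern isEmptyElim) * hw'

theorem tangleSum_bigon (ε τ : ℤˣ) (p : X × X) (F : (Fin 2 ⊕ Fin 2 → ℕ) → R) :
    β.tangleSum ![ε, -ε] (fun _ => p) (Course.bigon τ) F =
      F ((Course.bare 2).pattern isEmptyElim) := by
  have hδ := (β.isLoopValue_ratio_zpow ε p).eq
  simp only [tangleSum_eq, sum_smoothing_fin_two, Fin.prod_univ_two, Fin.sum_univ_two,
    Matrix.cons_val_zero, Matrix.cons_val_one, Units.val_neg, zpow_neg, add_neg_cancel, neg_zero,
    zpow_zero, mul_inv_cancel, Units.val_one, one_mul]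
  generalize β.ratio p ^ (ε : ℤ) = r at hδ ⊢
  have hr := r.mul_inv
  rcases Int.units_eq_one_or τ with rfl | rfl
  · have hA : (Course.bigon 1).pattern ![.A, .A] = (Course.bare 2).pattern isEmptyElim := by
      decide +kernel
    have hB : ∀ ρ ∈ [![Smoothing.A, .B], ![.B, .A]],
        (Course.bigon 1).pattern ρ = (Course.bigon 1).pattern ![.B, .B] := by decide +kernel
    have hl : ∀ ρ, (Course.bigon 1).loops ρ = if ρ = ![.B, .B] then 1 else 0 := by decide +kernel
    simp only [List.forall_mem_cons, List.not_mem_nil, false_imp_iff, implies_true, and_true] at hB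
    simp [hA, hB, hl, ratioWeight]
    linear_combination F ((Course.bigon 1).pattern ![.B, .B]) * hδ
  · have hB : (Course.bigon (-1)).pattern ![.B, .B] = (Course.bare 2).pattern isEmptyElim := by
      decide +kernel
    have hA : ∀ ρ ∈ [![Smoothing.A, .B], ![.B, .A]],
        (Course.bigon (-1)).pattern ρ = (Course.bigon (-1)).pattern ![.A, .A] := by decide +kernel
    have hl : ∀ ρ, (Course.bigon (-1)).loops ρ = if ρ = ![.A, .A] then 1 else 0 := by decide +kernel
    simp only [List.forall_mem_cons, List.not_mem_nil, false_imp_iff, implies_true, and_true] at hA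
    simp [hA, hB, hl, ratioWeight]
    linear_combination F ((Course.bigon (-1)).pattern ![.A, .A]) * hδ

theorem tangleSum_bare {m : ℕ} (hm : (Course.bare m).loops isEmptyElim = 0) (sg : Empty → ℤˣ)
    (l : Empty → X × X) (F : (Fin m ⊕ Fin m → ℕ) → R) :
    β.tangleSum sg l (Course.bare m) F = F ((Course.bare m).pattern isEmptyElim) := by
  rw [tangleSum_of_isEmpty, hm, pow_zero, one_mul]

/-! ### Moves -/

theorem kink_over_labels {ε : ℤˣ} {e e' c x y : X} (he : e = e')
    (h : CrossingColors ε c e' e c x y) : x = y := by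
  rcases Int.units_eq_one_or ε with rfl | rfl
  · exact h.pos.1.symm.trans h.pos.2.2.2
  · exact h.neg.2.1.symm.trans (he.symm.trans h.neg.2.2.1)

theorem kink_under_labels {ε : ℤˣ} {e e' c x y : X} (he : e = e')
    (h : CrossingColors ε e c c e' x y) : x = y := by
  rcases Int.units_eq_one_or ε with rfl | rfl
  · exact h.pos.1.symm.trans (he.trans h.pos.2.2.2)
  · exact h.neg.2.1.symm.trans h.neg.2.2.1

/-- The two crossings of a bigon have the same labels. -/
theorem bigon_labels {ε τ : ℤˣ} {κ : Fin 2 ⊕ (Fin 2 × Strand ⊕ Empty) → X} {p q : X × X}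
    (h₀ : CrossingColors ε (κ (Sum.inr (Sum.inl (0, .lower))))
      (κ ((Course.bigon τ).succ (Sum.inl (0, .lower)))) (κ (Sum.inr (Sum.inl (0, .upper))))
      (κ ((Course.bigon τ).succ (Sum.inl (0, .upper)))) p.1 p.2)
    (h₁ : CrossingColors (-ε) (κ (Sum.inr (Sum.inl (1, .lower))))
      (κ ((Course.bigon τ).succ (Sum.inl (1, .lower)))) (κ (Sum.inr (Sum.inl (1, .upper))))
      (κ ((Course.bigon τ).succ (Sum.inl (1, .upper)))) q.1 q.2) : p = q := by
  have hne : (-1 : ℤˣ) ≠ 1 := by decide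
  rcases Int.units_eq_one_or ε with rfl | rfl <;> rcases Int.units_eq_one_or τ with rfl | rfl <;>
    simp [CrossingColors, Course.bigon, hne] at h₀ h₁ <;> rw [Prod.ext_iff] <;>
    grind [Biquandle.under_injective, Biquandle.over_injective, Biquandle.sideways_injective]

/-- The bracket is invariant under each move: the colors on the boundary of the disc determine the
labels inside, up to the form in which they enter the local identities. -/
theorem traceBracket_eq_of_coloredMove {D D' : ColoredTraceDiagram X} (h : ColoredMove D D') :
    β.traceBracket D = β.traceBracket D' := by
  obtain ⟨m, T, T', hT, O, port, I, I', hcolor, hnext⟩ := h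
  cases hT with
  | relabel =>
    refine β.traceBracket_eq_of_tangleSum_eq I I' hcolor hnext (Course.describes_bare I)
      (Course.describes_bare I') fun F => ?_
    rw [tangleSum_of_isEmpty, tangleSum_of_isEmpty]
  | subdivide =>
    refine β.traceBracket_eq_of_tangleSum_eq I I' hcolor hnext (Course.describes_bare I)
      (Course.describes_marked I') fun F => ?_
    rw [tangleSum_of_isEmpty, tangleSum_of_isEmpty]
    have hp : (Course.bare 1).pattern isEmptyElim = Course.marked.pattern isEmptyElim := by
      decide +kernel
    have hl : (Course.bare 1).loops isEmptyElim = Course.marked.loops isEmptyElim := by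
      decide +kernel
    rw [hp, hl]
  | moveI_over ε =>
    have hc := Course.describes_bare I
    have hc' := Course.describes_kink (a := .upper) (b := .lower) (by decide) I'
    refine β.traceBracket_eq_of_tangleSum_eq I I' hcolor hnext hc hc' fun F => ?_
    have hl := kink_over_labels
      ((Insertion.stopColor_first hnext hc hc' 0).symm.trans (Insertion.stopColor_exit hcolor 0))
      (I'.crossingColors hc' ())
    rw [β.tangleSum_bare (by decide +kernel)]
    refine (β.tangleSum_kink ε (a := .upper) (b := .lower) (by decide) (I'.label ()).1 F).symm.trans ?_
    congr 1
    exact funext fun _ => Prod.ext rfl hl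
  | moveI_under ε =>
    have hc := Course.describes_bare I
    have hc' := Course.describes_kink (a := .lower) (b := .upper) (by decide) I'
    refine β.traceBracket_eq_of_tangleSum_eq I I' hcolor hnext hc hc' fun F => ?_
    have hl := kink_under_labels
      ((Insertion.stopColor_first hnext hc hc' 0).symm.trans (Insertion.stopColor_exit hcolor 0))
      (I'.crossingColors hc' ())
    rw [β.tangleSum_bare (by decide +kernel)]
    refine (β.tangleSum_kink ε (a := .lower) (b := .upper) (by decide) (I'.label ()).1 F).symm.trans ?_
    congr 1
    exact funext fun _ => Prod.ext rfl hl
  | moveII ε τ =>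
    have hc' := Course.describes_bigon I'
    refine β.traceBracket_eq_of_tangleSum_eq I I' hcolor hnext (Course.describes_bare I) hc'
      fun F => ?_
    have hl := bigon_labels (I'.crossingColors hc' 0) (I'.crossingColors hc' 1)
    rw [β.tangleSum_bare (by decide +kernel)]
    refine (β.tangleSum_bigon ε τ (I'.label 0) F).symm.trans ?_
    congr 1
    funext s
    fin_cases s
    exacts [rfl, hl]
  | moveIII ε =>
    have hc := Course.describes_triangle I
    have hc' := Course.describes_triangle I'
    refine β.traceBracket_eq_of_tangleSum_eq I I' hcolor hnext hc hc' fun F => ?_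
    obtain ⟨x, y, z, hl⟩ := triangle_labels ε I.stopColor I'.stopColor I.label I'.label
      (Insertion.stopColor_exit hcolor) (Insertion.stopColor_first hnext hc hc')
      (I.crossingColors hc) (I'.crossingColors hc')
    exact β.tangleSum_triangle ε hl F

end BiquandleBracket

theorem mainTheorem5 {X : Type*} [Finite X] [Biquandle X] {R : Type*} [CommRing R]
    (β : BiquandleBracket X R) :
    (∃! br : ColoredTraceDiagram X → R, β.IsTraceBracket br) ∧
    ∀ br : ColoredTraceDiagram X → R, β.IsTraceBracket br →
      (∀ L L' : ColoredTraceDiagram X, L.IsLinkDiagram → L'.IsLinkDiagram →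
        ColoredReidemeisterEquiv L L' → br L = br L') ∧
      ∀ L : ColoredTraceDiagram X, L.IsLinkDiagram → br L = β.stateSum L := by
  have hbr := β.isTraceBracket_traceBracket
  refine ⟨⟨β.traceBracket, hbr, fun br h => h.eq hbr⟩, fun br h => ?_⟩
  obtain rfl := h.eq hbr
  refine ⟨fun L L' hL₁ hL₂ hL => ?_, fun L hL => β.traceBracket_eq_stateSum hL⟩
  clear hL₁ hL₂
  induction hL with
  | rel D D' h => exact β.traceBracket_eq_of_coloredMove h
  | refl => rfl
  | symm _ _ _ ih => exact ih.symm
  | trans _ _ _ _ _ ih₁ ih₂ => exact ih₁.trans ih₂
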